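/- Let $n\ge 1$ be an integer and $0<s<1$. For a unit vector $\theta\in\mathbb R^n$ let $D^s_\theta$ denote the positive Riemann–Liouville derivative of order $s$ in direction $\theta$, $$D^s_\theta u(x)=\frac{1}{\Gamma(1-s)}\,\frac{d}{dt}\int_0^\infty u\big(x+(t-t')\theta\big)\,(t')^{-s}\,dt'\Big|_{t=0},$$ understood for $u\in L^2(\mathbb R^n)$ in the weak sense: $g=D^s_\theta u\in L^2(\mathbb R^n)$ if $\int g\,\varphi\,dx=\int u\,D^s_{-\theta}\varphi\,dx$ for all real $\varphi\in C_c^\infty(\mathbb R^n)$. Define, as absolutely convergent $L^2$-valued integrals with respect to the surface measure $d\theta$ of the unit sphere, $$\mathbf{grad}^s u=\int_{|\theta|=1}\theta\,D^s_\theta u\,d\theta,\qquad \mathbf{div}^s v=\int_{|\theta|=1}\theta\cdot D^s_\theta v\,d\theta,$$ where $D^s_\theta v=(D^s_\theta v_1,\dots,D^s_\theta v_n)$, and $$(-\Delta)^s u(x)=C_{n,s}\,\mathrm{p.v.}\!\int_{\mathbb R^n}\frac{u(x)-u(y)}{|x-y|^{n+2s}}\,dy,\qquad C_{n,s}=\frac{4^s\,\Gamma(s+\frac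 n2)}{\pi^{n/2}\,|\Gamma(-s)|},$$ the principal value being the limit in $L^2(\mathbb R^n)$, as $\varepsilon\downarrow0$, of the integrals over $|x-y|>\varepsilon$. Then there is a real constant $D_{n,s}<0$, depending only on $n$ and $s$, such that (with principal complex powers) $$\int_{|\theta|=1}\int_{|\theta'|=1}\theta\cdot\theta'\,(i\theta\cdot\xi)^s\,(i\theta'\cdot\xi)^s\,d\theta'\,d\theta=D_{n,s}\,|\xi|^{2s}\qquad\text{for all }\xi\in\mathbb R^n,$$ and for every complex-valued (in particular every real-valued) $u\in H^{2s}(\mathbb R^n)$ the fields $\mathbf{grad}^s u$, $\mathbf{div}^s\,\mathbf{grad}^s u$ and $(-\Delta)^s u$ are well defined in $L^2$ and $$\mathbf{div}^s\,\mathbf{grad}^s u=D_{n,s}\,(-\Delta)^s u .$$ -/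

import Mathlib

open MeasureTheory Filter Set
open scoped Topology ENNReal ContDiff SchwartzMap

noncomputable section

namespace FracCalc

/-- Euclidean space `ℝⁿ`. -/
abbrev Sp (n : ℕ) := EuclideanSpace ℝ (Fin n)

/-- `L²(ℝⁿ)` (complex-valued, so real-valued functions are included). -/
abbrev L2 (n : ℕ) := Lp ℂ 2 (volume : Measure (Sp n))

/-- The unit sphere `{θ ∈ ℝⁿ : |θ| = 1}`. -/
abbrev USphere (n : ℕ) := Metric.sphere (0 : Sp n) 1

/-- The surface measure `dθ` on the unit sphere, normalised so that `dy = r ^ (n - 1) dr dθ` in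
polar coordinates (for `n = 1`: the counting measure on `{-1, 1}`). -/
abbrev surf (n : ℕ) : Measure (USphere n) := (volume : Measure (Sp n)).toSphere

/-- Membership of `u ∈ L²(ℝⁿ)` in the Sobolev space `H^r(ℝⁿ)`, i.e.
`∫ (1 + |ξ|²) ^ r |û(ξ)|² dξ < ∞`. -/
def MemH {n : ℕ} (r : ℝ) (u : L2 n) : Prop :=
  TemperedDistribution.MemSobolev r 2 (u : 𝓢'(Sp n, ℂ))

/-! ### Directional fractional derivative -/

/-- The one-dimensional positive Riemann-Liouville derivative of order `s ∈ (0,1)`,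
`(d^s w / dt^s)(t) = Γ(1-s)⁻¹ (d/dt) ∫_0^∞ w(t - t') t'^(-s) dt'`. -/
def rlDeriv (s : ℝ) (w : ℝ → ℝ) (t : ℝ) : ℝ :=
  (Real.Gamma (1 - s))⁻¹ *
    deriv (fun τ : ℝ => ∫ t' in Ioi (0 : ℝ), w (τ - t') * t' ^ (-s)) t

/-- The directional derivative `D_θ^s φ (x)`: the Riemann-Liouville derivative of
`t ↦ φ (x + t θ)`, evaluated at `t = 0`. -/
def rlDirDeriv {n : ℕ} (s : ℝ) (θ : Sp n) (φ : Sp n → ℝ) (x : Sp n) : ℝ :=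
  rlDeriv s (fun t : ℝ => φ (x + t • θ)) 0

/-- `g = D_θ^s u` for `u, g ∈ L²(ℝⁿ)`, in the weak sense: the formal transpose of the
Riemann-Liouville derivative in the direction `θ` is the one in the direction `-θ`, so that
`∫ g φ = ∫ u D_{-θ}^s φ` for all test functions `φ ∈ C_c^∞(ℝⁿ)`, with the classical
`D_{-θ}^s φ` on the right. -/
def IsDirDeriv {n : ℕ} (s : ℝ) (θ : Sp n) (u g : L2 n) : Prop :=
  ∀ φ : Sp n → ℝ, ContDiff ℝ ∞ φ → HasCompactSupport φ →
    ∫ x, (φ x : ℂ) * g x = ∫ x, (rlDirDeriv s (-θ) φ x : ℂ) * u x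

/-- A weak directional derivative in `L²` is unique. -/
theorem IsDirDeriv.unique {n : ℕ} {s : ℝ} {θ : Sp n} {u g g' : L2 n}
    (h : IsDirDeriv s θ u g) (h' : IsDirDeriv s θ u g') : g = g' := by
  apply Lp.ext
  apply ae_eq_of_integral_contDiff_smul_eq
  · exact (Lp.memLp g).locallyIntegrable (by norm_num)
  · exact (Lp.memLp g').locallyIntegrable (by norm_num)
  · intro φ hφ hc
    simpa using (h φ hφ hc).trans (h' φ hφ hc).symm

open Classical in
/-- The directional derivative `D_θ^s u ∈ L²(ℝⁿ)` (with the value `0` if it does not exist). -/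
def dirDeriv {n : ℕ} (s : ℝ) (θ : Sp n) (u : L2 n) : L2 n :=
  if h : ∃ g, IsDirDeriv s θ u g then h.choose else 0

theorem IsDirDeriv.dirDeriv_eq {n : ℕ} {s : ℝ} {θ : Sp n} {u g : L2 n}
    (h : IsDirDeriv s θ u g) : dirDeriv s θ u = g := by
  have hex : ∃ g, IsDirDeriv s θ u g := ⟨g, h⟩
  rw [dirDeriv, dif_pos hex]
  exact hex.choose_spec.unique h

/-! ### Directional fractional gradient and divergence -/

/-- The directional fractional gradient `∫_{|θ|=1} θ D_θ^s u dθ`, as an `L²` vector field;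
its `i`-th component is the `L²`-valued integral of `θ_i D_θ^s u`. -/
def fracGrad {n : ℕ} (s : ℝ) (u : L2 n) : Fin n → L2 n :=
  fun i => ∫ θ : USphere n, (θ : Sp n) i • dirDeriv s (θ : Sp n) u ∂(surf n)

/-- The fractional gradient of `u` is well defined in `L²`: all derivatives `D_θ^s u` exist in
`L²` and the integral over the sphere converges absolutely in `L²`. -/
def HasFracGrad {n : ℕ} (s : ℝ) (u : L2 n) : Prop :=
  (∀ θ : USphere n, ∃ g, IsDirDeriv s (θ : Sp n) u g) ∧
  ∀ i, Integrable (fun θ : USphere n => (θ : Sp n) i • dirDeriv s (θ : Sp n) u) (surf n)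

/-- The directional fractional divergence `∫_{|θ|=1} θ · D_θ^s v dθ`, where
`D_θ^s v = (D_θ^s v_1, …, D_θ^s v_n)`. -/
def fracDiv {n : ℕ} (s : ℝ) (v : Fin n → L2 n) : L2 n :=
  ∫ θ : USphere n, ∑ i, (θ : Sp n) i • dirDeriv s (θ : Sp n) (v i) ∂(surf n)

/-- The fractional divergence of `v` is well defined in `L²`. -/
def HasFracDiv {n : ℕ} (s : ℝ) (v : Fin n → L2 n) : Prop :=
  (∀ (θ : USphere n) (i : Fin n), ∃ g, IsDirDeriv s (θ : Sp n) (v i) g) ∧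
  Integrable (fun θ : USphere n => ∑ i, (θ : Sp n) i • dirDeriv s (θ : Sp n) (v i)) (surf n)

/-! ### The fractional Laplacian -/

/-- The constant `C_{n,s} = 4^s Γ(s + n/2) / (π^(n/2) |Γ(-s)|)`. -/
def lapConst (n : ℕ) (s : ℝ) : ℝ :=
  4 ^ s * Real.Gamma (s + n / 2) / (Real.pi ^ ((n : ℝ) / 2) * |Real.Gamma (-s)|)

/-- The truncated integral
`C_{n,s} ∫_{|x-y| > ε} (u(x) - u(y)) / |x-y|^(n+2s) dy`. -/
def truncLap {n : ℕ} (s ε : ℝ) (u : Sp n → ℂ) (x : Sp n) : ℂ :=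
  (lapConst n s : ℂ) *
    ∫ y in {y : Sp n | ε < ‖x - y‖}, (u x - u y) / ((‖x - y‖ ^ ((n : ℝ) + 2 * s) : ℝ) : ℂ)

/-- `f = (-Δ)^s u`: the principal value integral
`C_{n,s} p.v. ∫ (u(x) - u(y)) / |x-y|^(n+2s) dy` converges to `f` in `L²(ℝⁿ)`. -/
def IsFracLap {n : ℕ} (s : ℝ) (u f : L2 n) : Prop :=
  (∀ ε : ℝ, 0 < ε → MemLp (truncLap s ε u) 2 (volume : Measure (Sp n))) ∧
  Tendsto (fun ε : ℝ => eLpNorm (truncLap s ε u - (f : Sp n → ℂ)) 2 (volume : Measure (Sp n)))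
    (𝓝[>] 0) (𝓝 0)

/-- The `L²` principal value is unique. -/
theorem IsFracLap.unique {n : ℕ} {s : ℝ} {u f f' : L2 n}
    (h : IsFracLap s u f) (h' : IsFracLap s u f') : f = f' := by
  have key : eLpNorm ((f : Sp n → ℂ) - (f' : Sp n → ℂ)) 2 (volume : Measure (Sp n)) ≤ 0 := by
    have hlim := h.2.add h'.2
    rw [add_zero] at hlim
    refine ge_of_tendsto hlim ?_
    filter_upwards [self_mem_nhdsWithin] with ε hε
    have hT := (h.1 ε hε).aestronglyMeasurable
    have hf := (Lp.memLp f).aestronglyMeasurable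
    have hf' := (Lp.memLp f').aestronglyMeasurable
    have he : (f : Sp n → ℂ) - (f' : Sp n → ℂ) = (truncLap s ε u - (f' : Sp n → ℂ)) -
        (truncLap s ε u - (f : Sp n → ℂ)) := by
      abel
    rw [he, add_comm]
    exact eLpNorm_sub_le (hT.sub hf') (hT.sub hf) (by norm_num)
  have h0 := (eLpNorm_eq_zero_iff
    ((Lp.memLp f).aestronglyMeasurable.sub (Lp.memLp f').aestronglyMeasurable)
    (by norm_num)).1 (le_antisymm key bot_le)
  apply Lp.ext
  filter_upwards [h0] with x hx
  simpa [sub_eq_zero] using hx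

open Classical in
/-- The (Riesz) fractional Laplacian `(-Δ)^s u ∈ L²(ℝⁿ)` (with the value `0` if the principal
value does not exist). -/
def fracLap {n : ℕ} (s : ℝ) (u : L2 n) : L2 n :=
  if h : ∃ f, IsFracLap s u f then h.choose else 0

theorem IsFracLap.fracLap_eq {n : ℕ} {s : ℝ} {u f : L2 n}
    (h : IsFracLap s u f) : fracLap s u = f := by
  have hex : ∃ f, IsFracLap s u f := ⟨f, h⟩
  rw [fracLap, dif_pos hex]
  exact hex.choose_spec.unique h

/-! ### The spherical double integral -/

/-- `∫_{|θ|=1} ∫_{|θ'|=1} θ·θ' (i θ·ξ)^s (i θ'·ξ)^s dθ' dθ`, with principal complex powers. -/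
def sphereIntegral (n : ℕ) (s : ℝ) (ξ : Sp n) : ℂ :=
  ∫ θ : USphere n, ∫ θ' : USphere n,
    ((inner ℝ (θ : Sp n) (θ' : Sp n) : ℝ) : ℂ)
      * (Complex.I * ((inner ℝ (θ : Sp n) ξ : ℝ) : ℂ)) ^ (s : ℂ)
      * (Complex.I * ((inner ℝ (θ' : Sp n) ξ : ℝ) : ℂ)) ^ (s : ℂ) ∂(surf n) ∂(surf n)

end FracCalc

end

noncomputable section

namespace FracCalc
open scoped FourierTransform

variable {n : ℕ} {s : ℝ}

/-! Every operator involved is a Fourier multiplier. Since the transform uses the phase `2π⟨x, ξ⟩`,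
all symbols are evaluated at η = 2πξ.

Integration by parts puts the Riemann–Liouville derivative in Marchaud form, a singular integral of
differences, whose symbol is (iθ·η)^s (`rlDeriv_zero_eq`, `kerSymbol_ray`). The truncated Laplacians
are also integrals of differences; their symbols lie between 0 and |η|^{2s} and tend to |η|^{2s},
which is what C_{n,s} is chosen for (`lapConst_mul_integral`). Both definitions are linked to their
symbols by one duality formula, `integral_kernel_sub_mul`: a difference operator acting on a test
function is paired with u and moved to the Fourier side by Fubini and the bilinear Parseval
identity.

Integrating over the sphere gives the gradient the vector symbol G(η) = ∫ θ (iθ·η)^s dθ, so div grad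
has symbol ΣG_i(η)², which is also the spherical double integral (`sphereIntegral_eq_sum`).
Reflections show that G(η) is parallel to η, and pairing antipodal points gives G(η)·η = i sin(πs/2)
∫|θ·η|^{1+s} dθ (`gradSymbol_eq`). The square of the factor i makes the constant negative, and
homogeneity with rotation invariance gives |η|^{2s} (`sum_gradSymbol_sq`). For u in H^{2s} all the
products of symbols with û that occur are in L², and injectivity of the Fourier transform concludes.
-/

/-! ### Parseval pairing, translations and characters. -/

theorem integral_fourier_mul (ψ : 𝓢(Sp n, ℂ)) (h : L2 n) :
    ∫ x, (𝓕 ψ) x * h x = ∫ ξ, ψ ξ * (𝓕 h : L2 n) ξ := by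
  have := congrArg (fun T : 𝓢'(Sp n, ℂ) => T ψ) (Lp.fourier_toTemperedDistribution_eq h)
  simpa [TemperedDistribution.fourier_apply, Lp.toTemperedDistribution_apply] using this

theorem integral_mul_eq_integral_fourierInv (φ : 𝓢(Sp n, ℂ)) (h : L2 n) :
    ∫ x, φ x * h x = ∫ ξ, (𝓕⁻ φ) ξ * (𝓕 h : L2 n) ξ := by
  simpa using integral_fourier_mul (𝓕⁻ φ) h

/-- The character `ξ ↦ exp (-2 π i ⟨z, ξ⟩)`. -/
def chr (z ξ : Sp n) : ℂ := Complex.exp (-(2 * Real.pi * Complex.I * (inner ℝ z ξ : ℝ)))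

theorem norm_chr (z ξ : Sp n) : ‖chr z ξ‖ = 1 := by
  rw [chr, show -(2 * Real.pi * Complex.I * ((inner ℝ z ξ : ℝ) : ℂ))
    = ((-(2 * Real.pi * inner ℝ z ξ) : ℝ) : ℂ) * Complex.I by push_cast; ring]
  exact Complex.norm_exp_ofReal_mul_I _

theorem continuous_chr : Continuous (fun p : Sp n × Sp n => chr p.1 p.2) := by
  unfold chr; fun_prop

theorem fourierInv_compSubConst (φ : 𝓢(Sp n, ℂ)) (z ξ : Sp n) :
    (𝓕⁻ (φ.compSubConstCLM ℂ (-z))) ξ = chr z ξ * (𝓕⁻ φ) ξ := by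
  rw [SchwartzMap.fourierInv_coe, SchwartzMap.fourierInv_coe, Real.fourierInv_eq',
    Real.fourierInv_eq', ← integral_const_mul]
  rw [← integral_add_right_eq_self (μ := volume) _ (-z)]
  apply integral_congr_ae
  filter_upwards with x
  simp only [SchwartzMap.compSubConstCLM_apply, chr, smul_eq_mul, sub_neg_eq_add,
    neg_add_cancel_right]
  rw [← mul_assoc, ← Complex.exp_add]
  congr 2
  rw [inner_add_left, inner_neg_left]
  push_cast
  ring

theorem integral_translate_mul (φ : 𝓢(Sp n, ℂ)) (u : L2 n) (z : Sp n) :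
    ∫ x, φ (x + z) * u x = ∫ ξ, (chr z ξ * (𝓕⁻ φ) ξ) * (𝓕 u : L2 n) ξ := by
  have := integral_mul_eq_integral_fourierInv (φ.compSubConstCLM ℂ (-z)) u
  simp only [SchwartzMap.compSubConstCLM_apply, sub_neg_eq_add] at this
  rw [this]
  simp_rw [fourierInv_compSubConst]

theorem norm_one_sub_exp_neg_le {w : ℂ} (hw : 0 ≤ w.re) :
    ‖1 - Complex.exp (-w)‖ ≤ 2 * min 1 ‖w‖ := by
  rcases le_total ‖w‖ 1 with h | h
  · rw [min_eq_right h, norm_sub_rev]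
    simpa using Complex.norm_exp_sub_one_le (x := -w) (by simpa using h)
  · rw [min_eq_left h]
    refine (norm_sub_le _ _).trans ?_
    have : ‖Complex.exp (-w)‖ ≤ 1 := by
      rw [Complex.norm_exp]; simpa using hw
    simp; linarith

/-- The trivial bound for large z and the linear bound for small z are merged into a product, so
that the z-dependence can be integrated against a kernel and the ξ-dependence absorbed by a Schwartz
function. Here 14 = 2 · 7 with 7 ≥ 2π. -/
theorem norm_one_sub_chr_le (z ξ : Sp n) :
    ‖1 - chr z ξ‖ ≤ 14 * (min 1 ‖z‖ * (1 + ‖ξ‖)) := by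
  have h := norm_one_sub_exp_neg_le (w := 2 * Real.pi * Complex.I * (inner ℝ z ξ : ℝ)) (by simp)
  refine h.trans ?_
  have h1 : ‖2 * Real.pi * Complex.I * ((inner ℝ z ξ : ℝ) : ℂ)‖ ≤ 7 * (‖z‖ * ‖ξ‖) := by
    simp only [norm_mul, Complex.norm_I, Complex.norm_real, Complex.norm_ofNat, mul_one]
    have := abs_real_inner_le_norm z ξ
    rw [Real.norm_eq_abs, Real.norm_eq_abs, abs_of_pos Real.pi_pos]
    have hp : 2 * Real.pi ≤ 7 := by linarith [Real.pi_lt_d2]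
    exact mul_le_mul hp this (abs_nonneg _) (by norm_num)
  rcases le_total ‖z‖ 1 with hz | hz
  · rw [min_eq_right hz]
    have := (min_le_right 1 _).trans h1
    nlinarith [norm_nonneg z, norm_nonneg ξ, mul_nonneg (norm_nonneg z) (norm_nonneg ξ)]
  · rw [min_eq_left hz]
    have := min_le_left 1 ‖2 * Real.pi * Complex.I * ((inner ℝ z ξ : ℝ) : ℂ)‖
    nlinarith [norm_nonneg z, norm_nonneg ξ]

theorem integrable_mul_of_memLp_two {α : Type*} [MeasurableSpace α] {μ : Measure α} {f g : α → ℂ}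
    (hf : MemLp f 2 μ) (hg : MemLp g 2 μ) : Integrable (fun x => f x * g x) μ :=
  hf.integrable_mul hg

/-- Bessel weight times a Schwartz function lies in `L²`. -/
theorem memLp_weight_schwartz (ψ : 𝓢(Sp n, ℂ)) :
    MemLp (fun ξ => ((1 + ‖ξ‖ : ℝ) : ℂ) * ψ ξ) 2 (volume : Measure (Sp n)) := by
  have h1 : MemLp ψ 2 (volume : Measure (Sp n)) := ψ.memLp 2 _
  have h2 : MemLp (SchwartzMap.smulLeftCLM ℂ (fun ξ : Sp n => (((1 + ‖ξ‖ ^ 2) : ℝ) : ℂ)) ψ) 2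
    (volume : Measure (Sp n)) := SchwartzMap.memLp _ 2 _
  refine MemLp.of_le_mul (c := 2) h2 ?_ ?_
  · have := ψ.continuous
    exact Continuous.aestronglyMeasurable (by fun_prop)
  · filter_upwards with ξ
    rw [SchwartzMap.smulLeftCLM_apply_apply (by fun_prop)]
    simp only [smul_eq_mul, norm_mul, Complex.norm_real, Real.norm_eq_abs]
    rw [abs_of_nonneg (by positivity), abs_of_nonneg (by positivity), ← mul_assoc]
    refine mul_le_mul_of_nonneg_right ?_ (norm_nonneg _)
    nlinarith [sq_nonneg (‖ξ‖ - 1), norm_nonneg ξ]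

theorem measurable_chr {β : Type*} [MeasurableSpace β] {f g : β → Sp n} (hf : Measurable f)
    (hg : Measurable g) : Measurable (fun b => chr (f b) (g b)) := by
  unfold chr
  have h : Measurable (fun b => inner ℝ (f b) (g b)) := hf.inner hg
  fun_prop

/-- By Plancherel, the difference has the L² norm of (1 − chr z) · 𝓕⁻φ, which `norm_one_sub_chr_le`
controls. -/
theorem eLpNorm_sub_translate_le (φ : 𝓢(Sp n, ℂ)) (z : Sp n) :
    eLpNorm (fun x => φ x - φ (x + z)) 2 (volume : Measure (Sp n)) ≤
      ENNReal.ofReal (14 * min 1 ‖z‖) *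
        eLpNorm (fun ξ => ((1 + ‖ξ‖ : ℝ) : ℂ) * (𝓕⁻ φ) ξ) 2 (volume : Measure (Sp n)) := by
  set χ : 𝓢(Sp n, ℂ) := φ - φ.compSubConstCLM ℂ (-z) with hχ
  have e1 : eLpNorm (fun x => φ x - φ (x + z)) 2 (volume : Measure (Sp n))
      = eLpNorm (𝓕⁻ χ : 𝓢(Sp n, ℂ)) 2 (volume : Measure (Sp n)) := by
    have h1 : ‖χ.toLp 2‖ₑ = ‖(𝓕⁻ χ : 𝓢(Sp n, ℂ)).toLp 2‖ₑ := by
      rw [← SchwartzMap.toLp_fourierInv_eq, ← ofReal_norm, ← ofReal_norm,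
        ← Lp.norm_fourier_eq (𝓕⁻ (χ.toLp 2 volume) : L2 n)]
      simp
    rw [Lp.enorm_def, Lp.enorm_def, eLpNorm_congr_ae (χ.coeFn_toLp 2 _),
      eLpNorm_congr_ae ((𝓕⁻ χ : 𝓢(Sp n, ℂ)).coeFn_toLp 2 _)] at h1
    rw [← h1]
    congr 1
    ext x
    simp [hχ, SchwartzMap.compSubConstCLM_apply]
  rw [e1]
  have h2 : ∀ ξ, ‖(𝓕⁻ χ : 𝓢(Sp n, ℂ)) ξ‖ ≤ (14 * min 1 ‖z‖) * ‖((1 + ‖ξ‖ : ℝ) : ℂ) * (𝓕⁻ φ) ξ‖ := by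
    intro ξ
    have : (𝓕⁻ χ : 𝓢(Sp n, ℂ)) ξ = (1 - chr z ξ) * (𝓕⁻ φ) ξ := by
      have h3 : (𝓕⁻ χ : 𝓢(Sp n, ℂ)) = 𝓕⁻ φ - 𝓕⁻ (φ.compSubConstCLM ℂ (-z)) :=
        map_sub (FourierTransform.fourierInvCLM ℂ 𝓢(Sp n, ℂ)) φ (φ.compSubConstCLM ℂ (-z))
      rw [h3, sub_apply, fourierInv_compSubConst]
      ring
    rw [this, norm_mul, norm_mul, Complex.norm_real, Real.norm_eq_abs,
      abs_of_nonneg (by positivity), ← mul_assoc, mul_assoc 14]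
    exact mul_le_mul_of_nonneg_right (norm_one_sub_chr_le z ξ) (norm_nonneg _)
  exact eLpNorm_le_mul_eLpNorm_of_ae_le_mul (ae_of_all _ h2) 2

/-! ### Difference operators with singular kernels and their symbols. -/

section kernel

variable {α : Type*} [MeasurableSpace α] {μ : Measure α} {k : α → ℝ} {z : α → Sp n}

/-- Cauchy–Schwarz in x for each fixed a, then the L² bound on translation differences. Only k ·
min(1, ‖z‖) has to be integrable, so the kernel may be singular where z = 0. -/
theorem integrable_kernel_sub_mul [SFinite μ] (hk : Measurable k) (hz : Measurable z)
    (hkz : Integrable (fun a => k a * min 1 ‖z a‖) μ) (φ : 𝓢(Sp n, ℂ)) (u : L2 n) :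
    Integrable (fun p : Sp n × α => (k p.2 : ℂ) * (φ p.1 - φ (p.1 + z p.2)) * u p.1)
      ((volume : Measure (Sp n)).prod μ) := by
  have hmeas : AEStronglyMeasurable
      (fun p : Sp n × α => (k p.2 : ℂ) * (φ p.1 - φ (p.1 + z p.2)) * u p.1)
      ((volume : Measure (Sp n)).prod μ) := by
    have hφ := φ.continuous.measurable
    refine AEStronglyMeasurable.mul ?_ (Lp.aestronglyMeasurable u).comp_fst
    exact Measurable.aestronglyMeasurable (by fun_prop)
  refine ⟨hmeas, ?_⟩
  set N := eLpNorm (fun ξ => ((1 + ‖ξ‖ : ℝ) : ℂ) * (𝓕⁻ φ) ξ) 2 (volume : Measure (Sp n)) with hN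
  have hNf : N < ⊤ := (memLp_weight_schwartz (𝓕⁻ φ)).2
  have huf : eLpNorm u 2 (volume : Measure (Sp n)) < ⊤ := (Lp.memLp u).2
  have hb : ∀ a, ∫⁻ x, ‖(k a : ℂ) * (φ x - φ (x + z a)) * u x‖ₑ ≤
      ‖k a * min 1 ‖z a‖‖ₑ * (14 * N * eLpNorm u 2 (volume : Measure (Sp n))) := by
    intro a
    have h1 : ∫⁻ x, ‖(φ x - φ (x + z a)) * u x‖ₑ ≤
        eLpNorm (fun x => φ x - φ (x + z a)) 2 (volume : Measure (Sp n)) *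
          eLpNorm u 2 (volume : Measure (Sp n)) := by
      rw [← eLpNorm_one_eq_lintegral_enorm]
      refine eLpNorm_smul_le_mul_eLpNorm (φ := fun x => φ x - φ (x + z a))
        (Lp.aestronglyMeasurable u) ?_
      have := φ.continuous
      exact Continuous.aestronglyMeasurable (by fun_prop)
    have h2 := eLpNorm_sub_translate_le φ (z a)
    calc ∫⁻ x, ‖(k a : ℂ) * (φ x - φ (x + z a)) * u x‖ₑ
        = ‖k a‖ₑ * ∫⁻ x, ‖(φ x - φ (x + z a)) * u x‖ₑ := by
          rw [← lintegral_const_mul' _ _ (by simp)]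
          congr 1; ext x
          rw [mul_assoc, enorm_mul]
          congr 1
          simp [enorm_eq_nnnorm]
      _ ≤ ‖k a‖ₑ * (ENNReal.ofReal (14 * min 1 ‖z a‖) * N *
          eLpNorm u 2 (volume : Measure (Sp n))) := by
          gcongr
          exact h1.trans (by gcongr)
      _ = _ := by
          rw [enorm_mul, ENNReal.ofReal_mul (by norm_num),
            Real.enorm_eq_ofReal (r := min 1 ‖z a‖) (by positivity)]
          norm_num
          ring
  rw [HasFiniteIntegral, lintegral_prod_symm _ hmeas.enorm]
  refine (lintegral_mono hb).trans_lt ?_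
  rw [lintegral_mul_const'' _ hkz.aestronglyMeasurable.enorm]
  refine ENNReal.mul_lt_top hkz.2 ?_
  exact ENNReal.mul_lt_top (ENNReal.mul_lt_top (by simp) hNf) huf

/-- Symbol of the difference operator `u ↦ ∫ k a (u - u (· - z a)) dμ(a)`. -/
def kerSymbol (μ : Measure α) (k : α → ℝ) (z : α → Sp n) (ξ : Sp n) : ℂ :=
  ∫ a, (k a : ℂ) * (1 - chr (z a) ξ) ∂μ

theorem integrable_kernel_symbol_mul (hk : Measurable k) (hz : Measurable z)
    (hkz : Integrable (fun a => k a * min 1 ‖z a‖) μ) (ψ : 𝓢(Sp n, ℂ)) (v : L2 n) :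
    Integrable (fun p : Sp n × α => (k p.2 : ℂ) * (1 - chr (z p.2) p.1) * (ψ p.1 * v p.1))
      ((volume : Measure (Sp n)).prod μ) := by
  have hA : Integrable (fun ξ => (((1 + ‖ξ‖ : ℝ) : ℂ) * ψ ξ) * v ξ) (volume : Measure (Sp n)) :=
    integrable_mul_of_memLp_two (memLp_weight_schwartz _) (Lp.memLp _)
  have hB : Integrable (fun p : Sp n × α => 14 *
      (‖(((1 + ‖p.1‖ : ℝ) : ℂ) * ψ p.1) * v p.1‖ * ‖k p.2 * min 1 ‖z p.2‖‖))
      ((volume : Measure (Sp n)).prod μ) := (hA.norm.mul_prod hkz.norm).const_mul 14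
  refine hB.mono' ?_ ?_
  · have hψ := ψ.continuous.measurable
    have hc : Measurable (fun p : Sp n × α => chr (z p.2) p.1) :=
      measurable_chr (hz.comp measurable_snd) measurable_fst
    have h1 : AEStronglyMeasurable (fun p : Sp n × α => (k p.2 : ℂ) * (1 - chr (z p.2) p.1))
        ((volume : Measure (Sp n)).prod μ) :=
      Measurable.aestronglyMeasurable (by fun_prop)
    have h2 : AEStronglyMeasurable (fun p : Sp n × α => ψ p.1)
        ((volume : Measure (Sp n)).prod μ) :=
      Measurable.aestronglyMeasurable (by fun_prop)
    exact h1.mul (h2.mul (Lp.aestronglyMeasurable v).comp_fst)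
  · filter_upwards with p
    have := norm_one_sub_chr_le (z p.2) p.1
    simp only [norm_mul, Complex.norm_real, Real.norm_eq_abs]
    rw [abs_of_nonneg (by positivity : 0 ≤ 1 + ‖p.1‖),
      abs_of_nonneg (by positivity : 0 ≤ min 1 ‖z p.2‖)]
    calc _ ≤ |k p.2| * (14 * (min 1 ‖z p.2‖ * (1 + ‖p.1‖))) * (‖ψ p.1‖ * ‖v p.1‖) := by gcongr
      _ = _ := by ring

/-- Fubini reduces the identity to a single translation, where Parseval turns φ(· + z) into
multiplication by a character; a second Fubini on the Fourier side reassembles the symbol. This is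
what lets the weak definitions be tested on symbols. -/
theorem integral_kernel_sub_mul [SFinite μ] (hk : Measurable k) (hz : Measurable z)
    (hkz : Integrable (fun a => k a * min 1 ‖z a‖) μ) (φ : 𝓢(Sp n, ℂ)) (u : L2 n) :
    ∫ x, (∫ a, (k a : ℂ) * (φ x - φ (x + z a)) ∂μ) * u x =
      ∫ ξ, (𝓕⁻ φ) ξ * (kerSymbol μ k z ξ * (𝓕 u : L2 n) ξ) := by
  have hI := integrable_kernel_sub_mul hk hz hkz φ u
  have hJ := integrable_kernel_symbol_mul hk hz hkz (𝓕⁻ φ) (𝓕 u)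
  calc ∫ x, (∫ a, (k a : ℂ) * (φ x - φ (x + z a)) ∂μ) * u x
      = ∫ x, ∫ a, (k a : ℂ) * (φ x - φ (x + z a)) * u x ∂μ := by
        simp_rw [integral_mul_const]
    _ = ∫ a, (∫ x, (k a : ℂ) * (φ x - φ (x + z a)) * u x) ∂μ := integral_integral_swap hI
    _ = ∫ a, (∫ ξ, (k a : ℂ) * (1 - chr (z a) ξ) * ((𝓕⁻ φ) ξ * (𝓕 u : L2 n) ξ)) ∂μ := by
        congr 1; ext a
        have e1 : Integrable (fun x => φ x * u x) (volume : Measure (Sp n)) :=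
          integrable_mul_of_memLp_two (φ.memLp 2 _) (Lp.memLp _)
        have e2 : Integrable (fun x => φ (x + z a) * u x) (volume : Measure (Sp n)) := by
          have := integrable_mul_of_memLp_two ((φ.compSubConstCLM ℂ (-z a)).memLp 2 volume)
            (Lp.memLp u)
          simpa [SchwartzMap.compSubConstCLM_apply] using this
        have e3 : Integrable (fun ξ => (𝓕⁻ φ) ξ * (𝓕 u : L2 n) ξ) (volume : Measure (Sp n)) :=
          integrable_mul_of_memLp_two ((𝓕⁻ φ).memLp 2 _) (Lp.memLp _)
        have e4 : Integrable (fun ξ => chr (z a) ξ * (𝓕⁻ φ) ξ * (𝓕 u : L2 n) ξ)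
            (volume : Measure (Sp n)) := by
          simp_rw [mul_assoc]
          refine e3.bdd_mul (c := 1) ?_ (ae_of_all _ fun ξ => (norm_chr _ _).le)
          exact (continuous_chr.comp (by fun_prop : Continuous fun ξ : Sp n =>
            (z a, ξ))).aestronglyMeasurable
        simp_rw [mul_assoc (k a : ℂ)]
        rw [integral_const_mul, integral_const_mul]
        congr 1
        simp_rw [sub_mul, one_mul]
        rw [integral_sub e1 e2, integral_translate_mul, integral_mul_eq_integral_fourierInv]
        rw [← integral_sub e3 e4]
        simp_rw [mul_assoc]
    _ = ∫ ξ, ∫ a, (k a : ℂ) * (1 - chr (z a) ξ) * ((𝓕⁻ φ) ξ * (𝓕 u : L2 n) ξ) ∂μ :=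
        (integral_integral_swap hJ).symm
    _ = _ := by
        simp_rw [integral_mul_const, kerSymbol]
        congr 1; ext ξ; ring

end kernel

/-! ### The Marchaud form of the one-dimensional derivative. -/

theorem integrableOn_rpow_mul_min (hs0 : 0 < s) (hs1 : s < 1) :
    IntegrableOn (fun t : ℝ => t ^ (-1 - s) * min 1 t) (Ioi 0) := by
  rw [← Ioc_union_Ioi_eq_Ioi (zero_le_one' ℝ)]
  refine IntegrableOn.union ?_ ?_
  · have h : IntegrableOn (fun t : ℝ => t ^ (-s)) (Ioc 0 1) := by
      rw [← intervalIntegrable_iff_integrableOn_Ioc_of_le zero_le_one]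
      exact intervalIntegral.intervalIntegrable_rpow' (by linarith)
    refine h.congr_fun (fun t ht => ?_) measurableSet_Ioc
    simp only
    rw [min_eq_right ht.2]
    nth_rewrite 3 [← Real.rpow_one t]
    rw [← Real.rpow_add ht.1]
    congr 1; ring
  · have h : IntegrableOn (fun t : ℝ => t ^ (-1 - s)) (Ioi 1) :=
      integrableOn_Ioi_rpow_of_lt (by linarith) one_pos
    refine h.congr_fun (fun t ht => ?_) measurableSet_Ioi
    simp only
    rw [min_eq_left (le_of_lt ht), mul_one]

/-- Integration by parts. The bound on U makes the boundary term U(t) t^{-s} of size t^{1-s} at 0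
and t^{-s} at infinity, so both ends vanish because 0 < s < 1. -/
theorem integral_rpow_mul_eq_deriv (hs0 : 0 < s) (hs1 : s < 1) {U U' : ℝ → ℝ} {C : ℝ}
    (hU : ∀ t ∈ Ioi (0 : ℝ), HasDerivAt U (U' t) t)
    (hb : ∀ t ∈ Ioi (0 : ℝ), |U t| ≤ C * min 1 t)
    (hi : IntegrableOn (fun t => U' t * t ^ (-s)) (Ioi 0)) :
    s * ∫ t in Ioi (0 : ℝ), t ^ (-1 - s) * U t = ∫ t in Ioi (0 : ℝ), U' t * t ^ (-s) := by
  have hv : ∀ t ∈ Ioi (0 : ℝ), HasDerivAt (fun t : ℝ => t ^ (-s)) (-s * t ^ (-s - 1)) t :=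
    fun t ht => Real.hasDerivAt_rpow_const (Or.inl (ne_of_gt ht))
  have hC : 0 ≤ C := by
    have := (abs_nonneg _).trans (hb 1 (by simp))
    simpa using this
  have hcont : ContinuousOn U (Ioi 0) := fun t ht => (hU t ht).continuousAt.continuousWithinAt
  have huv' : IntegrableOn (U * fun t => -s * t ^ (-s - 1)) (Ioi 0) := by
    refine ((integrableOn_rpow_mul_min hs0 hs1).const_mul (s * C)).mono' ?_ ?_
    · refine ContinuousOn.aestronglyMeasurable ?_ measurableSet_Ioi
      refine hcont.mul (continuousOn_const.mul ?_)
      exact ContinuousOn.rpow_const continuousOn_id fun x hx => Or.inl (ne_of_gt hx)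
    · refine (ae_restrict_iff' measurableSet_Ioi).2 (ae_of_all _ fun t ht => ?_)
      have ht' : (0 : ℝ) < t := ht
      simp only [Pi.mul_apply, norm_mul, Real.norm_eq_abs, abs_neg]
      rw [abs_of_pos hs0, abs_of_pos (Real.rpow_pos_of_pos ht' _),
        show -s - 1 = -1 - s by ring]
      have := hb t ht
      calc |U t| * (s * t ^ (-1 - s)) ≤ (C * min 1 t) * (s * t ^ (-1 - s)) := by gcongr
        _ = _ := by ring
  have h0 : Tendsto (U * fun t : ℝ => t ^ (-s)) (𝓝[>] 0) (𝓝 0) := by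
    refine squeeze_zero_norm' (a := fun t => C * t ^ (1 - s)) ?_ ?_
    · filter_upwards [self_mem_nhdsWithin] with t ht
      have ht' : (0 : ℝ) < t := ht
      simp only [Pi.mul_apply, norm_mul, Real.norm_eq_abs]
      rw [abs_of_pos (Real.rpow_pos_of_pos ht' _), sub_eq_add_neg, Real.rpow_add ht',
        Real.rpow_one, ← mul_assoc]
      gcongr
      exact (hb t ht).trans (mul_le_mul_of_nonneg_left (min_le_right _ _) hC)
    · have : Tendsto (fun t : ℝ => C * t ^ (1 - s)) (𝓝 0) (𝓝 (C * 0 ^ (1 - s))) :=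
        ((Real.continuousAt_rpow_const _ _ (Or.inr (by linarith))).tendsto).const_mul C
      rw [Real.zero_rpow (by linarith), mul_zero] at this
      exact this.mono_left nhdsWithin_le_nhds
  have hinf : Tendsto (U * fun t : ℝ => t ^ (-s)) atTop (𝓝 0) := by
    refine squeeze_zero_norm' (a := fun t => C * t ^ (-s)) ?_ ?_
    · filter_upwards [eventually_gt_atTop 0] with t ht'
      simp only [Pi.mul_apply, norm_mul, Real.norm_eq_abs]
      rw [abs_of_pos (Real.rpow_pos_of_pos ht' _)]
      gcongr
      exact (hb t ht').trans ((mul_le_mul_of_nonneg_left (min_le_left _ _) hC).trans (by simp))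
    · simpa using (tendsto_rpow_neg_atTop hs0).const_mul C
  have key := integral_Ioi_mul_deriv_eq_deriv_mul hU hv huv' hi h0 hinf
  rw [sub_self, zero_sub] at key
  rw [← neg_eq_iff_eq_neg] at key
  rw [← key, ← integral_neg, ← integral_const_mul]
  congr 1; ext t
  rw [show -s - 1 = -1 - s by ring]; ring

/-- Marchaud form of the Riemann-Liouville derivative. -/
theorem rlDeriv_zero_eq (hs0 : 0 < s) (hs1 : s < 1) {w : ℝ → ℝ} (hw : ContDiff ℝ ∞ w)
    (hc : HasCompactSupport w) :
    rlDeriv s w 0 = s / Real.Gamma (1 - s) *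
      ∫ t in Ioi (0 : ℝ), t ^ (-1 - s) * (w 0 - w (-t)) := by
  have hw1 : ContDiff ℝ 1 w := hw.of_le (by exact_mod_cast le_top)
  -- The fractional integral is the convolution of w with the locally integrable kernel t^{-s} on t
  -- > 0, so the outer derivative can be moved onto the smooth, compactly supported w.
  have hloc : LocallyIntegrable ((Ioi (0 : ℝ)).indicator fun t : ℝ => t ^ (-s)) := by
    have : LocallyIntegrable (fun t : ℝ => t ^ (-s)) := by
      rw [locallyIntegrable_iff]
      intro K hK
      obtain ⟨R, hR⟩ := hK.isBounded.subset_closedBall 0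
      refine IntegrableOn.mono_set ?_ hR
      rw [Real.closedBall_eq_Icc, zero_sub, zero_add]
      rcases le_total (-R) R with h | h
      · rw [integrableOn_Icc_iff_integrableOn_Ioc,
          ← intervalIntegrable_iff_integrableOn_Ioc_of_le h]
        exact intervalIntegral.intervalIntegrable_rpow' (by linarith)
      · refine IntegrableOn.mono_set (t := {R}) (integrableOn_singleton (hx := by simp)) ?_
        intro x hx
        simp only [mem_Icc] at hx
        simp only [mem_singleton_iff]; linarith
    exact this.indicator measurableSet_Ioi
  have hd := hc.hasDerivAt_convolution_right (ContinuousLinearMap.mul ℝ ℝ) hloc hw1 0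
  have e1 : ∀ (v : ℝ → ℝ) (x : ℝ), convolution ((Ioi (0 : ℝ)).indicator fun t : ℝ => t ^ (-s)) v
      (ContinuousLinearMap.mul ℝ ℝ) volume x = ∫ t in Ioi (0 : ℝ), v (x - t) * t ^ (-s) := by
    intro v x
    rw [convolution_def, ← integral_indicator measurableSet_Ioi]
    congr 1; ext t
    by_cases ht : t ∈ Ioi (0 : ℝ) <;> simp [ht, mul_comm]
  have e2 : (convolution ((Ioi (0 : ℝ)).indicator fun t : ℝ => t ^ (-s)) w
      (ContinuousLinearMap.mul ℝ ℝ) volume) = fun x => ∫ t in Ioi (0 : ℝ), w (x - t) * t ^ (-s) :=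
    funext (e1 w)
  rw [e2, e1] at hd
  rw [rlDeriv, hd.deriv]
  obtain ⟨K, hK⟩ := hw1.lipschitzWith_of_hasCompactSupport hc one_ne_zero
  obtain ⟨M, hM⟩ := hc.exists_bound_of_continuous hw.continuous
  have hM0 : 0 ≤ M := (norm_nonneg _).trans (hM 0)
  have hder : ∀ t ∈ Ioi (0 : ℝ), HasDerivAt (fun t => w 0 - w (-t)) (deriv w (0 - t)) t := by
    intro t _
    have h1 : HasDerivAt w (deriv w (-t)) (-t) :=
      ((hw1.differentiable one_ne_zero) (-t)).hasDerivAt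
    have h2 := (h1.scomp t (hasDerivAt_neg t)).const_sub (w 0)
    simpa using h2
  have hb : ∀ t ∈ Ioi (0 : ℝ), |w 0 - w (-t)| ≤ (K + 2 * M) * min 1 t := by
    intro t ht
    have ht' : (0 : ℝ) < t := ht
    have hl := hK.dist_le_mul 0 (-t)
    rw [Real.dist_eq, Real.dist_eq, sub_neg_eq_add, zero_add, abs_of_pos ht'] at hl
    have hm : |w 0 - w (-t)| ≤ 2 * M := by
      have h1 := hM 0
      have h2 := hM (-t)
      rw [Real.norm_eq_abs] at h1 h2
      exact (abs_sub _ _).trans (by linarith)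
    have hK0 : (0 : ℝ) ≤ K := K.2
    rcases le_total t 1 with h | h
    · rw [min_eq_right h]; nlinarith
    · rw [min_eq_left h]; linarith
  have hi : IntegrableOn (fun t => deriv w (0 - t) * t ^ (-s)) (Ioi 0) := by
    have hcd : HasCompactSupport (deriv w) := hc.deriv
    have := (hcd.convolutionExists_right (ContinuousLinearMap.mul ℝ ℝ) hloc
      (hw1.continuous_deriv le_rfl)) 0
    rw [ConvolutionExistsAt] at this
    rw [← integrable_indicator_iff measurableSet_Ioi]
    refine this.congr (ae_of_all _ fun t => ?_)
    by_cases ht : t ∈ Ioi (0 : ℝ) <;> simp [ht, mul_comm]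
  rw [← integral_rpow_mul_eq_deriv hs0 hs1 hder hb hi]
  ring

/-! ### The integral representation of z^s, continued from the positive axis to the imaginary axis.
-/

theorem integral_rpow_mul_one_sub_exp_real (hs0 : 0 < s) (hs1 : s < 1) {x : ℝ} (hx : 0 < x) :
    ∫ t in Ioi (0 : ℝ), t ^ (-1 - s) * (1 - Real.exp (-(x * t))) =
      Real.Gamma (1 - s) / s * x ^ s := by
  have h1 : ∀ t ∈ Ioi (0 : ℝ), HasDerivAt (fun t => 1 - Real.exp (-(x * t)))
      (x * Real.exp (-(x * t))) t := by
    intro t _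
    have : HasDerivAt (fun t => -(x * t)) (-x) t := by
      simpa using (hasDerivAt_id t).const_mul (-x)
    simpa [mul_comm] using (this.exp).const_sub 1
  have h2 : ∀ t ∈ Ioi (0 : ℝ), |1 - Real.exp (-(x * t))| ≤ (1 + x) * min 1 t := by
    intro t ht
    have ht' : (0 : ℝ) < t := ht
    have h3 : Real.exp (-(x * t)) ≤ 1 := Real.exp_le_one_iff.2 (by nlinarith)
    have h4 := Real.add_one_le_exp (-(x * t))
    have h5 := Real.exp_pos (-(x * t))
    rw [abs_of_nonneg (by linarith)]
    rcases le_total t 1 with h | h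
    · rw [min_eq_right h]; nlinarith
    · rw [min_eq_left h]; linarith
  have e := Real.integral_rpow_mul_exp_neg_mul_Ioi (a := 1 - s) (by linarith) hx
  have h3 : IntegrableOn (fun t => x * Real.exp (-(x * t)) * t ^ (-s)) (Ioi 0) := by
    have : IntegrableOn (fun t : ℝ => t ^ (1 - s - 1) * Real.exp (-(x * t))) (Ioi 0) := by
      -- A non-integrable function has integral 0 by convention, whereas the Gamma value is
      -- positive; this yields integrability for free.
      by_contra hcon
      rw [integral_undef hcon] at e
      have := Real.Gamma_pos_of_pos (by linarith : 0 < 1 - s)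
      have : 0 < (1 / x) ^ (1 - s) * Real.Gamma (1 - s) := by positivity
      linarith
    refine IntegrableOn.congr_fun (this.const_mul x) (fun t _ => ?_) measurableSet_Ioi
    rw [show 1 - s - 1 = -s by ring]; ring
  have key := integral_rpow_mul_eq_deriv hs0 hs1 h1 h2 h3
  have e2 : ∫ t in Ioi (0 : ℝ), x * Real.exp (-(x * t)) * t ^ (-s)
      = x * ((1 / x) ^ (1 - s) * Real.Gamma (1 - s)) := by
    rw [← e, ← integral_const_mul]
    congr 1; ext t
    rw [show 1 - s - 1 = -s by ring]; ring
  rw [e2] at key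
  rw [eq_comm, div_mul_eq_mul_div, div_eq_iff hs0.ne', mul_comm _ s, key, one_div,
    Real.inv_rpow hx.le, ← Real.rpow_neg hx.le, neg_sub]
  nth_rewrite 2 [← Real.rpow_one x]
  rw [← mul_assoc, ← Real.rpow_add hx]
  ring_nf

theorem integrableOn_rpow_mul_one_sub_exp (hs0 : 0 < s) (hs1 : s < 1) {z : ℂ} (hz : 0 ≤ z.re) :
    IntegrableOn (fun t : ℝ => ((t ^ (-1 - s) : ℝ) : ℂ) * (1 - Complex.exp (-(z * t)))) (Ioi 0) := by
  refine ((integrableOn_rpow_mul_min hs0 hs1).const_mul (2 * (1 + ‖z‖))).mono' ?_ ?_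
  · exact Measurable.aestronglyMeasurable (by fun_prop)
  · refine (ae_restrict_iff' measurableSet_Ioi).2 (ae_of_all _ fun t ht => ?_)
    have ht' : (0 : ℝ) < t := ht
    have hw : 0 ≤ (z * t).re := by simpa using mul_nonneg hz ht'.le
    have hb := norm_one_sub_exp_neg_le hw
    rw [norm_mul, Complex.norm_real, Real.norm_eq_abs, abs_of_pos (Real.rpow_pos_of_pos ht' _)]
    have h2 : min 1 ‖z * t‖ ≤ (1 + ‖z‖) * min 1 t := by
      rw [norm_mul, Complex.norm_real, Real.norm_eq_abs, abs_of_pos ht']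
      rcases le_total t 1 with h | h
      · rw [min_eq_right h]
        exact (min_le_right _ _).trans (by nlinarith [norm_nonneg z])
      · rw [min_eq_left h]
        exact (min_le_left _ _).trans (by nlinarith [norm_nonneg z])
    calc t ^ (-1 - s) * ‖1 - Complex.exp (-(z * t))‖
        ≤ t ^ (-1 - s) * (2 * ((1 + ‖z‖) * min 1 t)) := by gcongr; linarith
      _ = _ := by ring

/-- Both sides are holomorphic on the right half-plane and agree on the real axis near 1, so the
identity theorem applies. -/
theorem integral_rpow_mul_one_sub_exp_of_re_pos (hs0 : 0 < s) (hs1 : s < 1) {z : ℂ}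
    (hz : 0 < z.re) :
    ∫ t in Ioi (0 : ℝ), ((t ^ (-1 - s) : ℝ) : ℂ) * (1 - Complex.exp (-(z * t))) =
      ((Real.Gamma (1 - s) / s : ℝ) : ℂ) * z ^ (s : ℂ) := by
  set U : Set ℂ := {z | 0 < z.re}
  have hUo : IsOpen U := isOpen_lt continuous_const Complex.continuous_re
  set f : ℂ → ℂ := fun z =>
    ∫ t in Ioi (0 : ℝ), ((t ^ (-1 - s) : ℝ) : ℂ) * (1 - Complex.exp (-(z * t))) with hf
  set g : ℂ → ℂ := fun z => ((Real.Gamma (1 - s) / s : ℝ) : ℂ) * z ^ (s : ℂ) with hg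
  have hfd : DifferentiableOn ℂ f U := by
    intro z hz
    have hz' : 0 < z.re := hz
    -- On the half-plane Re w > Re z / 2 the differentiated integrand has one exponentially decaying
    -- majorant.
    have hV : {w : ℂ | z.re / 2 < w.re} ∈ 𝓝 z :=
      (isOpen_lt continuous_const Complex.continuous_re).mem_nhds (by simp; linarith)
    have hbi : IntegrableOn (fun t : ℝ => t ^ (-s) * Real.exp (-(z.re / 2 * t))) (Ioi 0) := by
      have := integrableOn_rpow_mul_exp_neg_mul_rpow (s := -s) (p := 1) (b := z.re / 2)
        (by linarith) one_pos (by linarith)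
      simpa using this
    have := hasDerivAt_integral_of_dominated_loc_of_deriv_le (μ := volume.restrict (Ioi (0 : ℝ)))
      (F := fun (z : ℂ) (t : ℝ) => ((t ^ (-1 - s) : ℝ) : ℂ) * (1 - Complex.exp (-(z * t))))
      (F' := fun (z : ℂ) (t : ℝ) => ((t ^ (-1 - s) : ℝ) : ℂ) * (Complex.exp (-(z * t)) * t))
      (bound := fun t : ℝ => t ^ (-s) * Real.exp (-(z.re / 2 * t))) hV
      (Eventually.of_forall fun w => Measurable.aestronglyMeasurable (by fun_prop))
      (integrableOn_rpow_mul_one_sub_exp hs0 hs1 hz'.le)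
      (Measurable.aestronglyMeasurable (by fun_prop)) ?_ hbi ?_
    · exact this.2.differentiableAt.differentiableWithinAt
    · refine (ae_restrict_iff' measurableSet_Ioi).2 (ae_of_all _ fun t ht w hw => ?_)
      have ht' : (0 : ℝ) < t := ht
      have hw' : z.re / 2 < w.re := hw
      rw [norm_mul, norm_mul, Complex.norm_real, Complex.norm_real, Real.norm_eq_abs,
        Real.norm_eq_abs, abs_of_pos (Real.rpow_pos_of_pos ht' _), abs_of_pos ht',
        Complex.norm_exp]
      have h1 : t ^ (-s) = t ^ (-1 - s) * t := by
        nth_rewrite 3 [← Real.rpow_one t]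
        rw [← Real.rpow_add ht']
        congr 1; ring
      rw [h1]
      have h2 : (-(w * t)).re ≤ -(z.re / 2 * t) := by
        simp only [Complex.neg_re, Complex.mul_re, Complex.ofReal_re, Complex.ofReal_im, mul_zero,
          sub_zero]
        nlinarith
      calc t ^ (-1 - s) * (Real.exp (-(w * t)).re * t)
          ≤ t ^ (-1 - s) * (Real.exp (-(z.re / 2 * t)) * t) := by gcongr
        _ = _ := by ring
    · refine ae_of_all _ fun t w _ => ?_
      have h1 : HasDerivAt (fun w : ℂ => -(w * t)) (-(t : ℂ)) w := by
        simpa [mul_comm] using (hasDerivAt_id w).const_mul (-(t : ℂ))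
      have h2 := ((h1.cexp.const_sub 1).const_mul ((t ^ (-1 - s) : ℝ) : ℂ))
      simpa using h2
  have hgd : DifferentiableOn ℂ g U := by
    intro z hz
    have hz' : z ∈ Complex.slitPlane := Or.inl hz
    exact ((differentiableAt_id.cpow_const hz').const_mul _).differentiableWithinAt
  have hpre : IsPreconnected U := (convex_halfSpace_re_gt 0).isPreconnected
  have h1U : (1 : ℂ) ∈ U := by simp [U]
  have hfreq : ∃ᶠ w in 𝓝[≠] (1 : ℂ), f w = g w := by
    have ht : Tendsto (fun x : ℝ => (x : ℂ)) (𝓝[>] (1 : ℝ)) (𝓝[≠] (1 : ℂ)) := by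
      refine tendsto_nhdsWithin_iff.2 ⟨?_, ?_⟩
      · have : Tendsto (fun x : ℝ => (x : ℂ)) (𝓝 1) (𝓝 ((1 : ℝ) : ℂ)) :=
          Complex.continuous_ofReal.tendsto 1
        simpa using this.mono_left nhdsWithin_le_nhds
      · filter_upwards [self_mem_nhdsWithin] with x hx
        have : (1 : ℝ) < x := hx
        simp only [mem_compl_iff, mem_singleton_iff]
        exact_mod_cast this.ne'
    refine ht.frequently (Eventually.frequently ?_)
    filter_upwards [self_mem_nhdsWithin] with x hx
    have hx0 : (0 : ℝ) < x := one_pos.trans hx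
    have := integral_rpow_mul_one_sub_exp_real hs0 hs1 hx0
    simp only [hf, hg]
    rw [← Complex.ofReal_cpow hx0.le, ← Complex.ofReal_mul, ← this, ← integral_complex_ofReal]
    congr 1; ext t
    push_cast
    ring
  exact (hfd.analyticOnNhd hUo).eqOn_of_preconnected_of_frequently_eq (hgd.analyticOnNhd hUo)
    hpre h1U hfreq hz

/-- Boundary value of the half-plane formula along ε + iy as ε ↓ 0. For y ≠ 0 the point iy lies off
the branch cut, so the principal power is continuous there; for y = 0 both sides vanish. -/
theorem integral_rpow_mul_one_sub_exp_I (hs0 : 0 < s) (hs1 : s < 1) (y : ℝ) :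
    ∫ t in Ioi (0 : ℝ), ((t ^ (-1 - s) : ℝ) : ℂ) * (1 - Complex.exp (-(Complex.I * y * t))) =
      ((Real.Gamma (1 - s) / s : ℝ) : ℂ) * (Complex.I * y) ^ (s : ℂ) := by
  by_cases hy : y = 0
  · have : (s : ℂ) ≠ 0 := by exact_mod_cast hs0.ne'
    simp [hy, this]
  have hslit : Complex.I * y ∈ Complex.slitPlane := Or.inr (by simpa using hy)
  have hcont : ContinuousAt (fun ε : ℝ => ((Real.Gamma (1 - s) / s : ℝ) : ℂ) *
      ((ε : ℂ) + Complex.I * y) ^ (s : ℂ)) 0 := by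
    refine continuousAt_const.mul ?_
    exact ContinuousAt.cpow (by fun_prop) continuousAt_const (by simpa using hslit)
  have h1 : Tendsto (fun ε : ℝ => ((Real.Gamma (1 - s) / s : ℝ) : ℂ) *
      ((ε : ℂ) + Complex.I * y) ^ (s : ℂ)) (𝓝[>] 0)
      (𝓝 (((Real.Gamma (1 - s) / s : ℝ) : ℂ) * (Complex.I * y) ^ (s : ℂ))) := by
    have := hcont.tendsto
    simp only [Complex.ofReal_zero, zero_add] at this
    exact this.mono_left nhdsWithin_le_nhds
  have h2 : Tendsto (fun ε : ℝ => ∫ t in Ioi (0 : ℝ), ((t ^ (-1 - s) : ℝ) : ℂ) *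
      (1 - Complex.exp (-(((ε : ℂ) + Complex.I * y) * t)))) (𝓝[>] 0)
      (𝓝 (∫ t in Ioi (0 : ℝ), ((t ^ (-1 - s) : ℝ) : ℂ) *
        (1 - Complex.exp (-(Complex.I * y * t))))) := by
    refine tendsto_integral_filter_of_dominated_convergence
      (fun t => 2 * (2 + |y|) * (t ^ (-1 - s) * min 1 t)) ?_ ?_
      ((integrableOn_rpow_mul_min hs0 hs1).const_mul _) ?_
    · exact Eventually.of_forall fun ε => Measurable.aestronglyMeasurable (by fun_prop)
    · have hε1 : ∀ᶠ ε : ℝ in 𝓝[>] 0, ε < 1 :=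
        mem_nhdsWithin_of_mem_nhds (Iio_mem_nhds one_pos)
      filter_upwards [self_mem_nhdsWithin, hε1] with ε hε hε1
      have hε0 : (0 : ℝ) < ε := hε
      refine (ae_restrict_iff' measurableSet_Ioi).2 (ae_of_all _ fun t ht => ?_)
      have ht' : (0 : ℝ) < t := ht
      have hw : 0 ≤ (((ε : ℂ) + Complex.I * y) * t).re := by
        simpa using mul_nonneg hε0.le ht'.le
      have hb := norm_one_sub_exp_neg_le hw
      rw [norm_mul, Complex.norm_real, Real.norm_eq_abs, abs_of_pos (Real.rpow_pos_of_pos ht' _)]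
      have hz : ‖(ε : ℂ) + Complex.I * y‖ ≤ 1 + |y| := by
        refine (norm_add_le _ _).trans ?_
        simp only [Complex.norm_real, Real.norm_eq_abs, norm_mul, Complex.norm_I, one_mul]
        rw [abs_of_pos hε0]; linarith
      have h2 : min 1 ‖((ε : ℂ) + Complex.I * y) * t‖ ≤ (2 + |y|) * min 1 t := by
        rw [norm_mul, Complex.norm_real, Real.norm_eq_abs, abs_of_pos ht']
        rcases le_total t 1 with h | h
        · rw [min_eq_right h]
          exact (min_le_right _ _).trans (mul_le_mul_of_nonneg_right (by linarith) ht'.le)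
        · rw [min_eq_left h]
          exact (min_le_left _ _).trans (by linarith [abs_nonneg y])
      calc t ^ (-1 - s) * ‖1 - Complex.exp (-(((ε : ℂ) + Complex.I * y) * t))‖
          ≤ t ^ (-1 - s) * (2 * ((2 + |y|) * min 1 t)) := by gcongr; linarith
        _ = _ := by ring
    · refine ae_of_all _ fun t => ?_
      have : Continuous fun ε : ℝ => ((t ^ (-1 - s) : ℝ) : ℂ) *
        (1 - Complex.exp (-(((ε : ℂ) + Complex.I * y) * t))) := by fun_prop
      have := this.tendsto 0
      simp only [Complex.ofReal_zero, zero_add] at this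
      exact this.mono_left nhdsWithin_le_nhds
  refine tendsto_nhds_unique (h2.congr' ?_) h1
  filter_upwards [self_mem_nhdsWithin] with ε hε
  exact integral_rpow_mul_one_sub_exp_of_re_pos hs0 hs1 (by simpa using hε)

/-! ### The multiplier of the directional derivative. -/

/-- The symbol `(i θ·ξ)^s` of the directional derivative `D_θ^s`. -/
def dirSymbol (s : ℝ) (θ ξ : Sp n) : ℂ := (Complex.I * ((inner ℝ θ ξ : ℝ) : ℂ)) ^ (s : ℂ)

theorem rlDirDeriv_neg_eq (hs0 : 0 < s) (hs1 : s < 1) {θ : Sp n} (hθ : ‖θ‖ = 1)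
    {φ : Sp n → ℝ} (hφ : ContDiff ℝ ∞ φ) (hc : HasCompactSupport φ) (x : Sp n) :
    rlDirDeriv s (-θ) φ x =
      ∫ t in Ioi (0 : ℝ), s / Real.Gamma (1 - s) * t ^ (-1 - s) * (φ x - φ (x + t • θ)) := by
  -- A unit-speed line is a closed embedding, so φ restricted to it keeps compact support.
  have hiso : Isometry (fun t : ℝ => x + t • (-θ)) := by
    refine Isometry.of_dist_eq fun a b => ?_
    rw [dist_add_left, dist_eq_norm, ← sub_smul, norm_smul, norm_neg, hθ, mul_one, ← dist_eq_norm]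
  have hcw : HasCompactSupport (fun t : ℝ => φ (x + t • (-θ))) :=
    hc.comp_isClosedEmbedding hiso.isClosedEmbedding
  have hw : ContDiff ℝ ∞ (fun t : ℝ => φ (x + t • (-θ))) := by fun_prop
  rw [rlDirDeriv, rlDeriv_zero_eq hs0 hs1 hw hcw, ← integral_const_mul]
  simp [mul_assoc]

/-- The Marchaud normalisation s/Γ(1−s) cancels the factor in `integral_rpow_mul_one_sub_exp_I`,
leaving exactly the principal power. -/
theorem kerSymbol_ray (hs0 : 0 < s) (hs1 : s < 1) (θ ξ : Sp n) :
    kerSymbol (volume.restrict (Ioi (0 : ℝ)))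
      (fun t => s / Real.Gamma (1 - s) * t ^ (-1 - s)) (fun t => t • θ) ξ =
    dirSymbol s θ ((2 * Real.pi) • ξ) := by
  have hG := Real.Gamma_pos_of_pos (by linarith : 0 < 1 - s)
  have h := integral_rpow_mul_one_sub_exp_I hs0 hs1 (inner ℝ θ ((2 * Real.pi) • ξ))
  have hc : ((s / Real.Gamma (1 - s) : ℝ) : ℂ) * ((Real.Gamma (1 - s) / s : ℝ) : ℂ) = 1 := by
    rw [← Complex.ofReal_mul, div_mul_div_cancel₀ hG.ne', div_self hs0.ne', Complex.ofReal_one]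
  rw [dirSymbol, ← one_mul (_ ^ _), ← hc, mul_assoc, ← h, kerSymbol, ← integral_const_mul]
  congr 1; ext t
  rw [chr, inner_smul_left, inner_smul_right]
  push_cast
  rw [mul_assoc]
  congr 4
  simp
  ring

/-- In Marchaud form D_{-θ}^s φ is an integral of φ(x) − φ(x + tθ), so the duality formula with z(t)
= tθ puts the symbol of D_θ^s on û. -/
theorem isDirDeriv_of_fourier (hs0 : 0 < s) (hs1 : s < 1) {θ : Sp n} (hθ : ‖θ‖ = 1) {u g : L2 n}
    (h : (𝓕 g : L2 n) =ᵐ[volume] fun ξ => dirSymbol s θ ((2 * Real.pi) • ξ) * (𝓕 u : L2 n) ξ) :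
    IsDirDeriv s θ u g := by
  intro φ hφ hc
  have hc' : HasCompactSupport (fun x => (φ x : ℂ)) := hc.comp_left (g := Complex.ofReal) rfl
  have hφ' : ContDiff ℝ ∞ (fun x => (φ x : ℂ)) := Complex.ofRealCLM.contDiff.comp hφ
  set Φ : 𝓢(Sp n, ℂ) := hc'.toSchwartzMap hφ' with hΦ
  have hΦx : ∀ x, Φ x = (φ x : ℂ) := fun x => rfl
  have hkz : Integrable (fun t : ℝ => s / Real.Gamma (1 - s) * t ^ (-1 - s) * min 1 ‖t • θ‖)
      (volume.restrict (Ioi (0 : ℝ))) := by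
    have := (integrableOn_rpow_mul_min hs0 hs1).const_mul (s / Real.Gamma (1 - s))
    refine IntegrableOn.congr_fun this (fun t ht => ?_) measurableSet_Ioi
    have ht' : (0 : ℝ) < t := ht
    rw [norm_smul, hθ, mul_one, Real.norm_eq_abs, abs_of_pos ht', mul_assoc]
  have key := integral_kernel_sub_mul (μ := volume.restrict (Ioi (0 : ℝ)))
    (k := fun t => s / Real.Gamma (1 - s) * t ^ (-1 - s)) (z := fun t : ℝ => t • θ)
    (by fun_prop) (by fun_prop) hkz Φ u
  have e1 : ∀ x, (rlDirDeriv s (-θ) φ x : ℂ) = ∫ t in Ioi (0 : ℝ),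
      ((s / Real.Gamma (1 - s) * t ^ (-1 - s) : ℝ) : ℂ) * (Φ x - Φ (x + t • θ)) := by
    intro x
    rw [rlDirDeriv_neg_eq hs0 hs1 hθ hφ hc, ← integral_complex_ofReal]
    congr 1; ext t
    rw [hΦx, hΦx]; push_cast; ring
  simp_rw [e1]
  rw [key]
  have e2 := integral_mul_eq_integral_fourierInv Φ g
  simp_rw [hΦx] at e2
  rw [e2]
  apply integral_congr_ae
  filter_upwards [h] with ξ hξ
  rw [hξ, kerSymbol_ray hs0 hs1]

/-! ### The Riesz kernel and the normalising constant of the Laplacian. -/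

theorem integral_gaussian_mul_one_sub_cos {b : ℝ} (hb : 0 < b) (ξ : Sp n) :
    Integrable (fun z : Sp n => Real.exp (-(b * ‖z‖ ^ 2)) * (1 - Real.cos (inner ℝ z ξ))) ∧
    ∫ z : Sp n, Real.exp (-(b * ‖z‖ ^ 2)) * (1 - Real.cos (inner ℝ z ξ)) =
      (Real.pi / b) ^ ((n : ℝ) / 2) * (1 - Real.exp (-(‖ξ‖ ^ 2 / 4 / b))) := by
  have hbc : 0 < (b : ℂ).re := by simpa using hb
  have i0 := GaussianFourier.integrable_cexp_neg_mul_sq_norm_add (V := Sp n) hbc 0 ξ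
  have i1 := GaussianFourier.integrable_cexp_neg_mul_sq_norm_add (V := Sp n) hbc Complex.I ξ
  have v0 := GaussianFourier.integral_cexp_neg_mul_sq_norm_add (V := Sp n) hbc 0 ξ
  have v1 := GaussianFourier.integral_cexp_neg_mul_sq_norm_add (V := Sp n) hbc Complex.I ξ
  have e : (fun z : Sp n => Real.exp (-(b * ‖z‖ ^ 2)) * (1 - Real.cos (inner ℝ z ξ))) =
      fun z => (Complex.exp (-(b : ℂ) * ‖z‖ ^ 2 + 0 * (inner ℝ ξ z : ℝ)) -
        Complex.exp (-(b : ℂ) * ‖z‖ ^ 2 + Complex.I * (inner ℝ ξ z : ℝ))).re := by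
    funext z
    have h1 : -(b : ℂ) * ‖z‖ ^ 2 + 0 * (inner ℝ ξ z : ℝ) = ((-(b * ‖z‖ ^ 2) : ℝ) : ℂ) := by
      push_cast; ring
    have h2 : -(b : ℂ) * ‖z‖ ^ 2 = ((-(b * ‖z‖ ^ 2) : ℝ) : ℂ) := by push_cast; ring
    rw [h1, h2, Complex.exp_add, mul_comm Complex.I, Complex.sub_re, ← Complex.ofReal_exp,
      Complex.ofReal_re, Complex.re_ofReal_mul, Complex.exp_ofReal_mul_I_re, real_inner_comm]
    ring
  have hint := i0.sub i1
  refine ⟨?_, ?_⟩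
  · rw [e]; exact hint.re
  · rw [e]
    have h3 := integral_re hint
    simp only [RCLike.re_to_complex, Pi.sub_apply] at h3
    rw [h3]
    have h4 := integral_sub i0 i1
    rw [h4, v0, v1]
    have hp : ((Real.pi : ℂ) / b) ^ ((Module.finrank ℝ (Sp n) : ℂ) / 2) =
        (((Real.pi / b) ^ ((n : ℝ) / 2) : ℝ) : ℂ) := by
      rw [Complex.ofReal_cpow (by positivity)]
      simp
    have hq : Complex.I ^ 2 * (‖ξ‖ : ℂ) ^ 2 / (4 * (b : ℂ)) =
        ((-(‖ξ‖ ^ 2 / 4 / b) : ℝ) : ℂ) := by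
      rw [Complex.I_sq]; push_cast; field_simp
    rw [hp, hq, ← Complex.ofReal_exp]
    simp only [ne_eq, OfNat.ofNat_ne_zero, not_false_eq_true, zero_pow, zero_mul, zero_div,
      Complex.exp_zero, mul_one]
    rw [← Complex.ofReal_mul, ← Complex.ofReal_sub, Complex.ofReal_re]
    ring

/-- The substitution t ↦ 1/t reduces this to `integral_rpow_mul_one_sub_exp_real`. -/
theorem integral_rpow_mul_one_sub_exp_div (hs0 : 0 < s) (hs1 : s < 1) {r : ℝ} (hr : 0 < r) :
    IntegrableOn (fun t : ℝ => t ^ (s - 1) * (1 - Real.exp (-(r / t)))) (Ioi 0) ∧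
    ∫ t in Ioi (0 : ℝ), t ^ (s - 1) * (1 - Real.exp (-(r / t))) =
      Real.Gamma (1 - s) / s * r ^ s := by
  set g : ℝ → ℝ := fun t => t ^ (-1 - s) * (1 - Real.exp (-(r * t))) with hg
  have hG := Real.Gamma_pos_of_pos (by linarith : 0 < 1 - s)
  have hv := integral_rpow_mul_one_sub_exp_real hs0 hs1 hr
  have hi : IntegrableOn g (Ioi 0) := by
    by_contra hcon
    rw [integral_undef hcon] at hv
    have : 0 < Real.Gamma (1 - s) / s * r ^ s := by positivity
    linarith
  have e : EqOn (fun x : ℝ => (|(-1 : ℝ)| * x ^ ((-1 : ℝ) - 1)) • g (x ^ (-1 : ℝ)))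
      (fun t : ℝ => t ^ (s - 1) * (1 - Real.exp (-(r / t)))) (Ioi 0) := by
    intro x hx
    have hx' : (0 : ℝ) < x := hx
    simp only [hg, smul_eq_mul, abs_neg, abs_one, one_mul]
    rw [← Real.rpow_mul hx'.le, ← mul_assoc, ← Real.rpow_add hx', Real.rpow_neg_one,
      ← div_eq_mul_inv]
    congr 2; ring
  refine ⟨?_, ?_⟩
  · have := (integrableOn_Ioi_comp_rpow_iff g (p := -1) (by norm_num)).2 hi
    exact this.congr_fun e measurableSet_Ioi
  · rw [← setIntegral_congr_fun measurableSet_Ioi e, integral_comp_rpow_Ioi g (by norm_num), hv]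

/-- Subordination to Gaussians: with a = s + n/2, Γ(a)‖z‖^{-2a} is the integral of t^{a-1}
e^{-t‖z‖²}. Integrating in z first, the Gaussian formula contributes t^{-n/2} and leaves a
one-dimensional integral in t. Nonnegativity of the integrand gives joint integrability. -/
theorem integral_one_sub_cos_mul_norm_rpow (hs0 : 0 < s) (hs1 : s < 1) (ξ : Sp n) :
    Integrable (fun z : Sp n => ‖z‖ ^ (-((n : ℝ) + 2 * s)) * (1 - Real.cos (inner ℝ z ξ))) ∧
    Real.Gamma (s + n / 2) *
      ∫ z : Sp n, ‖z‖ ^ (-((n : ℝ) + 2 * s)) * (1 - Real.cos (inner ℝ z ξ)) =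
      Real.pi ^ ((n : ℝ) / 2) * (Real.Gamma (1 - s) / s * (‖ξ‖ ^ 2 / 4) ^ s) := by
  by_cases hξ : ξ = 0
  · subst hξ
    simp [Real.zero_rpow hs0.ne']
  set a : ℝ := s + n / 2 with ha
  have ha0 : 0 < a := by positivity
  have hΓ := Real.Gamma_pos_of_pos ha0
  set r : ℝ := ‖ξ‖ ^ 2 / 4 with hr
  have hr0 : 0 < r := by have := norm_pos_iff.2 hξ; positivity
  set F : Sp n × ℝ → ℝ := fun p =>
    p.2 ^ (a - 1) * (Real.exp (-(p.2 * ‖p.1‖ ^ 2)) * (1 - Real.cos (inner ℝ p.1 ξ))) with hF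
  have hFm : Measurable F := by
    have h : Measurable fun p : Sp n × ℝ => inner ℝ p.1 ξ :=
      measurable_fst.inner measurable_const
    have h2 : Measurable fun p : Sp n × ℝ => ‖p.1‖ := measurable_fst.norm
    have h3 : Measurable fun p : Sp n × ℝ => Real.cos (inner ℝ p.1 ξ) :=
      Real.measurable_cos.comp h
    fun_prop
  have hFnn : ∀ z : Sp n, ∀ t ∈ Ioi (0 : ℝ), 0 ≤ F (z, t) := by
    intro z t ht
    have ht' : (0 : ℝ) < t := ht
    have := Real.cos_le_one (inner ℝ z ξ)
    have h2 : 0 ≤ 1 - Real.cos (inner ℝ z ξ) := by linarith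
    simp only [hF]; positivity
  have hinner : ∀ t ∈ Ioi (0 : ℝ), ∫ z : Sp n, F (z, t) =
      Real.pi ^ ((n : ℝ) / 2) * (t ^ (s - 1) * (1 - Real.exp (-(r / t)))) := by
    intro t ht
    have ht' : (0 : ℝ) < t := ht
    simp only [hF]
    rw [integral_const_mul, (integral_gaussian_mul_one_sub_cos ht' ξ).2,
      Real.div_rpow Real.pi_pos.le ht'.le, ← hr]
    have : t ^ (a - 1) = t ^ (s - 1) * t ^ ((n : ℝ) / 2) := by
      rw [← Real.rpow_add ht']; congr 1; rw [ha]; ring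
    rw [this]
    have := (Real.rpow_pos_of_pos ht' ((n : ℝ) / 2)).ne'
    field_simp
  obtain ⟨hhi, hhv⟩ := integral_rpow_mul_one_sub_exp_div hs0 hs1 hr0
  have hFi : Integrable F ((volume : Measure (Sp n)).prod (volume.restrict (Ioi (0 : ℝ)))) := by
    rw [integrable_prod_iff' hFm.aestronglyMeasurable]
    refine ⟨(ae_restrict_iff' measurableSet_Ioi).2 (ae_of_all _ fun t ht => ?_), ?_⟩
    · exact (integral_gaussian_mul_one_sub_cos ht ξ).1.const_mul (t ^ (a - 1))
    · refine IntegrableOn.congr_fun (hhi.const_mul (Real.pi ^ ((n : ℝ) / 2)))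
        (fun t ht => ?_) measurableSet_Ioi
      rw [← hinner t ht]
      congr 1; ext z
      rw [Real.norm_of_nonneg (hFnn z t ht)]
  have houter : ∀ z : Sp n, ∫ t in Ioi (0 : ℝ), F (z, t) =
      Real.Gamma a * (‖z‖ ^ (-((n : ℝ) + 2 * s)) * (1 - Real.cos (inner ℝ z ξ))) := by
    intro z
    by_cases hz : z = 0
    · simp [hF, hz]
    have hz0 : 0 < ‖z‖ := norm_pos_iff.2 hz
    simp only [hF]
    simp_rw [← mul_assoc]
    rw [integral_mul_const]
    congr 1
    have := Real.integral_rpow_mul_exp_neg_mul_Ioi ha0 (r := ‖z‖ ^ 2) (by positivity)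
    simp_rw [mul_comm (‖z‖ ^ 2)] at this
    rw [this, mul_comm]
    congr 1
    rw [one_div, ← Real.rpow_natCast, ← Real.rpow_neg hz0.le, ← Real.rpow_mul hz0.le]
    congr 1; rw [ha]; push_cast; ring
  refine ⟨?_, ?_⟩
  · have h := hFi.integral_prod_left.const_mul (Real.Gamma a)⁻¹
    refine h.congr (ae_of_all _ fun z => ?_)
    simp only
    rw [houter z, inv_mul_cancel_left₀ hΓ.ne']
  · rw [← integral_const_mul]
    simp_rw [← houter]
    rw [integral_integral_swap (f := fun z t => F (z, t)) hFi,
      setIntegral_congr_fun measurableSet_Ioi hinner, integral_const_mul, hhv]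

/-- Here |Γ(−s)| = Γ(1−s)/s by the functional equation, and 4^s cancels the quarter in (‖ξ‖²/4)^s.
-/
theorem lapConst_mul_integral (hs0 : 0 < s) (hs1 : s < 1) (ξ : Sp n) :
    lapConst n s * ∫ z : Sp n, ‖z‖ ^ (-((n : ℝ) + 2 * s)) * (1 - Real.cos (inner ℝ z ξ)) =
      ‖ξ‖ ^ (2 * s) := by
  have h := (integral_one_sub_cos_mul_norm_rpow hs0 hs1 ξ).2
  have hG := Real.Gamma_pos_of_pos (by linarith : 0 < 1 - s)
  have hg : |Real.Gamma (-s)| = Real.Gamma (1 - s) / s := by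
    have := Real.Gamma_add_one (s := -s) (by linarith)
    rw [show -s + 1 = 1 - s by ring] at this
    have h2 : Real.Gamma (-s) = -(Real.Gamma (1 - s) / s) := by
      rw [this]; field_simp
    rw [h2, abs_neg, abs_of_pos (by positivity)]
  have hr : (‖ξ‖ ^ 2 / 4) ^ s = ‖ξ‖ ^ (2 * s) / 4 ^ s := by
    rw [Real.div_rpow (by positivity) (by norm_num), ← Real.rpow_natCast,
      ← Real.rpow_mul (norm_nonneg _)]
    norm_num
  rw [hr] at h
  rw [lapConst, hg, div_mul_eq_mul_div, mul_assoc, h]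
  have : (0 : ℝ) < 4 ^ s := by positivity
  field_simp

theorem lapConst_nonneg (hs0 : 0 < s) : 0 ≤ lapConst n s := by
  have := (Real.Gamma_pos_of_pos (by positivity : 0 < s + (n : ℝ) / 2)).le
  unfold lapConst; positivity

/-! ### Difference operators with integrable kernel acting on L² functions. -/

section kernel

variable {α : Type*} [MeasurableSpace α] {μ : Measure α} {k : α → ℝ} {z : α → Sp n}

theorem integrable_mul_min_of_integrable {k : α → ℝ} {z : α → Sp n} (hz : Measurable z)
    (hki : Integrable k μ) : Integrable (fun a => k a * min 1 ‖z a‖) μ := by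
  refine hki.mul_bdd (c := 1) (Measurable.aestronglyMeasurable (by fun_prop)) (ae_of_all _ fun a => ?_)
  rw [Real.norm_of_nonneg (by positivity)]
  exact min_le_left _ _

/-- Integrability of k allows the two terms of the difference to be treated separately; translating
the second one moves the shift from u to φ. -/
theorem integral_mul_kernel_diff [SFinite μ] (hk : Measurable k) (hz : Measurable z)
    (hki : Integrable k μ) (φ : 𝓢(Sp n, ℂ)) (u : L2 n) :
    Integrable (fun x => φ x * ∫ a, (k a : ℂ) * (u x - u (x - z a)) ∂μ) ∧
    ∫ x, φ x * ∫ a, (k a : ℂ) * (u x - u (x - z a)) ∂μ =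
      ∫ x, (∫ a, (k a : ℂ) * (φ x - φ (x + z a)) ∂μ) * u x := by
  have hφu : Integrable (fun x => φ x * u x) (volume : Measure (Sp n)) :=
    integrable_mul_of_memLp_two (φ.memLp 2 _) (Lp.memLp _)
  have hF := (integrable_kernel_sub_mul hk hz (integrable_mul_min_of_integrable hz hki) φ u).swap
  have hA : Integrable (fun p : α × Sp n => (k p.1 : ℂ) * (φ p.2 * u p.2))
      (μ.prod (volume : Measure (Sp n))) := hki.ofReal.mul_prod hφu
  have hB : Integrable (fun p : α × Sp n => (k p.1 : ℂ) * (φ (p.2 + z p.1) * u p.2))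
      (μ.prod (volume : Measure (Sp n))) := by
    refine (hA.sub hF).congr (ae_of_all _ fun p => ?_)
    simp only [Pi.sub_apply, Function.comp_apply, Prod.fst_swap, Prod.snd_swap]
    ring
  -- The translation depends on a, so it is carried out as a measure-preserving shear of the product
  -- space.
  have hmp : MeasurePreserving (fun p : α × Sp n => (p.1, p.2 - z p.1))
      (μ.prod (volume : Measure (Sp n))) (μ.prod (volume : Measure (Sp n))) := by
    refine MeasurePreserving.skew_product (g := fun a x => x - z a) (MeasurePreserving.id μ) ?_
      (ae_of_all _ fun a => ?_)
    · exact measurable_snd.sub (hz.comp measurable_fst)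
    · exact (measurePreserving_sub_right (volume : Measure (Sp n)) (z a)).map_eq
  have hB' : Integrable (fun p : α × Sp n => (k p.1 : ℂ) * (φ p.2 * u (p.2 - z p.1)))
      (μ.prod (volume : Measure (Sp n))) := by
    have := hmp.integrable_comp_of_integrable hB
    refine this.congr (ae_of_all _ fun p => ?_)
    simp
  have hBB : ∫ p, (k p.1 : ℂ) * (φ p.2 * u (p.2 - z p.1)) ∂(μ.prod (volume : Measure (Sp n))) =
      ∫ p, (k p.1 : ℂ) * (φ (p.2 + z p.1) * u p.2) ∂(μ.prod (volume : Measure (Sp n))) := by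
    have h1 := integral_map (μ := μ.prod (volume : Measure (Sp n))) hmp.measurable.aemeasurable
      (f := fun p : α × Sp n => (k p.1 : ℂ) * (φ (p.2 + z p.1) * u p.2))
      (by rw [hmp.map_eq]; exact hB.aestronglyMeasurable)
    rw [hmp.map_eq] at h1
    rw [h1]
    simp
  have hC := hA.sub hB'
  have e1 : ∀ x, φ x * ∫ a, (k a : ℂ) * (u x - u (x - z a)) ∂μ =
      ∫ a, (k a : ℂ) * (φ x * u x) - (k a : ℂ) * (φ x * u (x - z a)) ∂μ := by
    intro x
    rw [← integral_const_mul]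
    congr 1; ext a; ring
  have e2 : ∀ x, (∫ a, (k a : ℂ) * (φ x - φ (x + z a)) ∂μ) * u x =
      ∫ a, (k a : ℂ) * (φ x * u x) - (k a : ℂ) * (φ (x + z a) * u x) ∂μ := by
    intro x
    rw [← integral_mul_const]
    congr 1; ext a; ring
  simp_rw [e1, e2]
  refine ⟨hC.integral_prod_right, ?_⟩
  have s1 := integral_prod_symm _ hC
  have s2 := integral_prod_symm _ (hA.sub hB)
  simp only [Pi.sub_apply] at s1 s2
  rw [← s1, ← s2, integral_sub hA hB', integral_sub hA hB, hBB]

/-- Both functions have the same pairings with test functions. Local integrability of the left side,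
needed to conclude, comes from pairing with a bump function equal to 1 on a given compact set. -/
theorem kernel_diff_ae_eq_of_fourier [SFinite μ] (hk : Measurable k) (hz : Measurable z)
    (hki : Integrable k μ) {u g : L2 n}
    (h : (𝓕 g : L2 n) =ᵐ[volume] fun ξ => kerSymbol μ k z ξ * (𝓕 u : L2 n) ξ) :
    (fun x => ∫ a, (k a : ℂ) * (u x - u (x - z a)) ∂μ) =ᵐ[volume] g := by
  set T : Sp n → ℂ := fun x => ∫ a, (k a : ℂ) * (u x - u (x - z a)) ∂μ
  have hloc : LocallyIntegrable T := by
    rw [locallyIntegrable_iff]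
    intro K hK
    obtain ⟨R, hR⟩ := hK.isBounded.subset_closedBall 0
    let f : ContDiffBump (0 : Sp n) := ⟨|R| + 1, |R| + 2, by positivity, by linarith⟩
    have hc' : HasCompactSupport (fun x => (f x : ℂ)) :=
      f.hasCompactSupport.comp_left (g := Complex.ofReal) rfl
    have hφ' : ContDiff ℝ ∞ (fun x => (f x : ℂ)) := Complex.ofRealCLM.contDiff.comp f.contDiff
    have := (integral_mul_kernel_diff hk hz hki (hc'.toSchwartzMap hφ') u).1
    refine IntegrableOn.congr_fun this.integrableOn (fun x hx => ?_) hK.measurableSet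
    have h1 : f x = 1 := f.one_of_mem_closedBall (by
      have h2 := hR hx
      simp only [Metric.mem_closedBall, dist_zero_right] at h2 ⊢
      exact h2.trans ((le_abs_self R).trans (by simp [f])))
    change (f x : ℂ) * T x = T x
    rw [h1]; simp
  refine ae_eq_of_integral_contDiff_smul_eq hloc
    ((Lp.memLp g).locallyIntegrable (by norm_num)) fun φ hφ hc => ?_
  have hc' : HasCompactSupport (fun x => (φ x : ℂ)) := hc.comp_left (g := Complex.ofReal) rfl
  have hφ' : ContDiff ℝ ∞ (fun x => (φ x : ℂ)) := Complex.ofRealCLM.contDiff.comp hφ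
  have h1 := (integral_mul_kernel_diff hk hz hki (hc'.toSchwartzMap hφ') u).2
  rw [integral_kernel_sub_mul hk hz (integrable_mul_min_of_integrable hz hki)] at h1
  have h2 := integral_mul_eq_integral_fourierInv (hc'.toSchwartzMap hφ') g
  calc ∫ x, φ x • T x = ∫ x, (hc'.toSchwartzMap hφ') x * T x := by
        congr 1
    _ = _ := h1
    _ = ∫ ξ, (𝓕⁻ (hc'.toSchwartzMap hφ')) ξ * (𝓕 g : L2 n) ξ := by
        refine integral_congr_ae ?_
        filter_upwards [h] with ξ hξ
        rw [hξ]
    _ = _ := h2.symm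
    _ = _ := by congr 1

end kernel

/-! ### Truncated Laplacians and the L² principal value. -/

theorem integrableOn_norm_rpow (hs0 : 0 < s) {ε : ℝ} (hε : 0 < ε) :
    IntegrableOn (fun z : Sp n => ‖z‖ ^ (-((n : ℝ) + 2 * s))) {z | ε < ‖z‖} := by
  have hp : 0 < (n : ℝ) + 2 * s := by positivity
  have h := integrable_one_add_norm (E := Sp n) (μ := volume) (r := (n : ℝ) + 2 * s)
    (by simp; linarith)
  have hS : MeasurableSet {z : Sp n | ε < ‖z‖} := measurableSet_lt measurable_const measurable_norm
  refine ((h.const_mul ((ε / (1 + ε)) ^ (-((n : ℝ) + 2 * s)))).integrableOn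
    (s := {z | ε < ‖z‖})).mono' (Measurable.aestronglyMeasurable (by fun_prop)) ?_
  refine (ae_restrict_iff' hS).2 (ae_of_all _ fun z hz => ?_)
  have hz' : ε < ‖z‖ := hz
  rw [Real.norm_of_nonneg (by positivity), ← Real.mul_rpow (by positivity) (by positivity)]
  refine Real.rpow_le_rpow_of_nonpos (by positivity) ?_ (by linarith)
  rw [div_mul_eq_mul_div, div_le_iff₀ (by positivity)]
  nlinarith

/-- The symbol of the truncated fractional Laplacian. -/
def truncSymbol (s ε : ℝ) (ξ : Sp n) : ℝ :=
  lapConst n s * ∫ z in {z : Sp n | ε < ‖z‖},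
    ‖z‖ ^ (-((n : ℝ) + 2 * s)) * (1 - Real.cos (inner ℝ z ((2 * Real.pi) • ξ)))

theorem kerSymbol_trunc (hs0 : 0 < s) {ε : ℝ} (hε : 0 < ε) (ξ : Sp n) :
    kerSymbol (volume.restrict {z : Sp n | ε < ‖z‖})
      (fun z => lapConst n s * ‖z‖ ^ (-((n : ℝ) + 2 * s))) id ξ = truncSymbol s ε ξ := by
  have hS : MeasurableSet {z : Sp n | ε < ‖z‖} := measurableSet_lt measurable_const measurable_norm
  set K : Sp n → ℝ := fun z => ‖z‖ ^ (-((n : ℝ) + 2 * s)) with hK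
  set η : Sp n := (2 * Real.pi) • ξ with hη
  have hKi : IntegrableOn K {z | ε < ‖z‖} := integrableOn_norm_rpow hs0 hε
  have hm : Measurable fun z : Sp n => inner ℝ z η := measurable_id.inner measurable_const
  have hc : IntegrableOn (fun z => K z * (1 - Real.cos (inner ℝ z η))) {z | ε < ‖z‖} := by
    refine hKi.mul_bdd (c := 2) (Measurable.aestronglyMeasurable (by fun_prop))
      (ae_of_all _ fun z => ?_)
    rw [Real.norm_eq_abs, abs_le]
    constructor <;> linarith [Real.cos_le_one (inner ℝ z η), Real.neg_one_le_cos (inner ℝ z η)]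
  have hsi : IntegrableOn (fun z => K z * Real.sin (inner ℝ z η)) {z | ε < ‖z‖} := by
    refine hKi.mul_bdd (c := 1) (Measurable.aestronglyMeasurable (by fun_prop))
      (ae_of_all _ fun z => ?_)
    exact Real.abs_sin_le_one _
  -- The sine part is odd on a symmetric domain, so the symbol is real.
  have hs : ∫ z in {z : Sp n | ε < ‖z‖}, K z * Real.sin (inner ℝ z η) = 0 := by
    rw [← integral_indicator hS]
    have := integral_neg_eq_self ({z : Sp n | ε < ‖z‖}.indicator
      fun z => K z * Real.sin (inner ℝ z η)) volume
    have h2 : ∀ z, ({z : Sp n | ε < ‖z‖}.indicator fun z => K z * Real.sin (inner ℝ z η)) (-z) =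
        -({z : Sp n | ε < ‖z‖}.indicator fun z => K z * Real.sin (inner ℝ z η)) z := by
      intro z
      by_cases hz : ε < ‖z‖ <;> simp [hz, hK, indicator]
    simp_rw [h2] at this
    rw [integral_neg] at this
    linarith
  have e : ∀ z, ((lapConst n s * K z : ℝ) : ℂ) * (1 - chr (id z) ξ) =
      (lapConst n s : ℂ) * ((K z * (1 - Real.cos (inner ℝ z η)) : ℝ) +
        Complex.I * (K z * Real.sin (inner ℝ z η) : ℝ)) := by
    intro z
    have h1 : chr (id z) ξ = Real.cos (inner ℝ z η) - Real.sin (inner ℝ z η) * Complex.I := by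
      rw [chr, hη, inner_smul_right, id, show -(2 * Real.pi * Complex.I * ((inner ℝ z ξ : ℝ) : ℂ))
        = ((-(2 * Real.pi * inner ℝ z ξ) : ℝ) : ℂ) * Complex.I by push_cast; ring,
        Complex.exp_mul_I, ← Complex.ofReal_cos, ← Complex.ofReal_sin, Real.cos_neg, Real.sin_neg]
      push_cast; ring
    rw [h1]; push_cast; ring
  change ∫ z in {z : Sp n | ε < ‖z‖}, ((lapConst n s * K z : ℝ) : ℂ) * (1 - chr (id z) ξ) = _
  simp_rw [e]
  rw [integral_const_mul, integral_add hc.ofReal (hsi.ofReal.const_mul _), integral_const_mul,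
    integral_complex_ofReal, integral_complex_ofReal, hs, truncSymbol]
  push_cast; ring

theorem truncSymbol_nonneg (hs0 : 0 < s) (ε : ℝ) (ξ : Sp n) : 0 ≤ truncSymbol s ε ξ := by
  refine mul_nonneg (lapConst_nonneg hs0) (integral_nonneg fun z => ?_)
  exact mul_nonneg (by positivity) (by
    linarith [Real.cos_le_one (inner ℝ z ((2 * Real.pi) • ξ))])

/-- The integrand is nonnegative, so removing a ball only decreases the integral. This bound,
uniform in ε, is the majorant for the limit ε ↓ 0. -/
theorem truncSymbol_le (hs0 : 0 < s) (hs1 : s < 1) (ε : ℝ) (ξ : Sp n) :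
    truncSymbol s ε ξ ≤ ‖(2 * Real.pi) • ξ‖ ^ (2 * s) := by
  rw [← lapConst_mul_integral hs0 hs1]
  refine mul_le_mul_of_nonneg_left ?_ (lapConst_nonneg hs0)
  refine setIntegral_le_integral (integral_one_sub_cos_mul_norm_rpow hs0 hs1 _).1
    (ae_of_all _ fun z => ?_)
  exact mul_nonneg (by positivity) (by
    linarith [Real.cos_le_one (inner ℝ z ((2 * Real.pi) • ξ))])

theorem tendsto_truncSymbol (hs0 : 0 < s) (hs1 : s < 1) (ξ : Sp n) :
    Tendsto (fun ε => truncSymbol s ε ξ) (𝓝[>] 0) (𝓝 (‖(2 * Real.pi) • ξ‖ ^ (2 * s))) := by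
  rw [← lapConst_mul_integral hs0 hs1]
  refine Tendsto.const_mul _ ?_
  have hS : ∀ ε : ℝ, MeasurableSet {z : Sp n | ε < ‖z‖} :=
    fun ε => measurableSet_lt measurable_const measurable_norm
  have hind : ∀ ε : ℝ, ∫ z in {z : Sp n | ε < ‖z‖},
      ‖z‖ ^ (-((n : ℝ) + 2 * s)) * (1 - Real.cos (inner ℝ z ((2 * Real.pi) • ξ))) =
      ∫ z, {z : Sp n | ε < ‖z‖}.indicator (fun z => ‖z‖ ^ (-((n : ℝ) + 2 * s)) *
        (1 - Real.cos (inner ℝ z ((2 * Real.pi) • ξ)))) z :=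
    fun ε => (integral_indicator (hS ε)).symm
  simp_rw [hind]
  have hi := (integral_one_sub_cos_mul_norm_rpow hs0 hs1 ((2 * Real.pi) • ξ)).1
  refine tendsto_integral_filter_of_dominated_convergence _ (Eventually.of_forall fun ε =>
    hi.aestronglyMeasurable.indicator (hS ε)) (Eventually.of_forall fun ε => ae_of_all _ fun z =>
    norm_indicator_le_norm_self _ _) hi.norm (ae_of_all _ fun z => ?_)
  by_cases hz : z = 0
  · subst hz
    refine tendsto_const_nhds.congr fun ε => ?_
    by_cases hε : ε < 0 <;> simp [indicator, hε]
  · refine tendsto_const_nhds.congr' ?_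
    have : ∀ᶠ ε : ℝ in 𝓝[>] 0, ε < ‖z‖ :=
      mem_nhdsWithin_of_mem_nhds (Iio_mem_nhds (norm_pos_iff.2 hz))
    filter_upwards [this] with ε hε
    rw [indicator_of_mem (by exact hε)]

theorem truncLap_eq (ε : ℝ) (u : Sp n → ℂ) (x : Sp n) :
    truncLap s ε u x = ∫ z in {z : Sp n | ε < ‖z‖},
      ((lapConst n s * ‖z‖ ^ (-((n : ℝ) + 2 * s)) : ℝ) : ℂ) * (u x - u (x - z)) := by
  have hS : MeasurableSet {z : Sp n | ε < ‖z‖} := measurableSet_lt measurable_const measurable_norm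
  have hS' : MeasurableSet {y : Sp n | ε < ‖x - y‖} :=
    measurableSet_lt measurable_const (by fun_prop)
  rw [truncLap, ← integral_const_mul, ← integral_indicator hS, ← integral_indicator hS']
  conv_rhs => rw [← integral_sub_left_eq_self _ _ x]
  congr 1; ext y
  by_cases hy : ε < ‖x - y‖
  · rw [indicator_of_mem (by exact hy), indicator_of_mem (by exact hy), sub_sub_cancel,
      Real.rpow_neg (norm_nonneg _)]
    push_cast
    field_simp
  · rw [indicator_of_notMem (by exact hy), indicator_of_notMem (by exact hy)]

theorem tendsto_eLpNorm_two_zero_of_dominated {ι : Type*} {l : Filter ι} [l.IsCountablyGenerated]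
    {F : ι → Sp n → ℂ} {b : Sp n → ℂ} (hF : ∀ᶠ i in l, AEStronglyMeasurable (F i) volume)
    (hb : MemLp b 2 volume) (hFb : ∀ᶠ i in l, ∀ᵐ ξ, ‖F i ξ‖ ≤ ‖b ξ‖)
    (hlim : ∀ᵐ ξ, Tendsto (fun i => F i ξ) l (𝓝 0)) :
    Tendsto (fun i => eLpNorm (F i) 2 volume) l (𝓝 0) := by
  have h2 : (2 : ℝ≥0∞) ≠ 0 := by norm_num
  have h2' : (2 : ℝ≥0∞) ≠ ⊤ := by norm_num
  simp_rw [eLpNorm_eq_lintegral_rpow_enorm_toReal h2 h2']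
  have hfin := (eLpNorm_lt_top_iff_lintegral_rpow_enorm_lt_top h2 h2').1 hb.2
  have key : Tendsto (fun i => ∫⁻ ξ, ‖F i ξ‖ₑ ^ (2 : ℝ≥0∞).toReal) l (𝓝 (∫⁻ _ : Sp n, 0)) := by
    refine tendsto_lintegral_filter_of_dominated_convergence'
      (fun ξ => ‖b ξ‖ₑ ^ (2 : ℝ≥0∞).toReal) ?_ ?_ hfin.ne ?_
    · filter_upwards [hF] with i hi
      exact hi.enorm.pow_const _
    · filter_upwards [hFb] with i hi
      filter_upwards [hi] with ξ hξ
      gcongr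
      exact enorm_le_iff_norm_le.2 hξ
    · filter_upwards [hlim] with ξ hξ
      have := (hξ.enorm).ennrpow_const (2 : ℝ≥0∞).toReal
      simpa using this
  simp only [lintegral_zero] at key
  have := key.ennrpow_const (1 / (2 : ℝ≥0∞).toReal)
  simpa using this

theorem exists_fourier_ae_eq {m : Sp n → ℂ} {v : L2 n}
    (h : MemLp (fun ξ => m ξ * v ξ) 2 volume) :
    ∃ g : L2 n, (𝓕 g : L2 n) =ᵐ[volume] fun ξ => m ξ * v ξ := by
  refine ⟨𝓕⁻ h.toLp, ?_⟩
  rw [FourierTransform.fourier_fourierInv_eq]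
  exact h.coeFn_toLp

theorem measurable_truncSymbol (ε : ℝ) : Measurable (truncSymbol s ε : Sp n → ℝ) := by
  unfold truncSymbol
  refine Measurable.const_mul ?_ _
  have h : Measurable fun p : Sp n × Sp n => ‖p.2‖ ^ (-((n : ℝ) + 2 * s)) *
      (1 - Real.cos (inner ℝ p.2 ((2 * Real.pi) • p.1))) := by
    have h1 : Measurable fun p : Sp n × Sp n => inner ℝ p.2 ((2 * Real.pi) • p.1) :=
      measurable_snd.inner (by fun_prop)
    have h2 : Measurable fun p : Sp n × Sp n => ‖p.2‖ := measurable_snd.norm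
    have h3 := Real.measurable_cos.comp h1
    exact (h2.pow_const _).mul (measurable_const.sub h3)
  exact (h.stronglyMeasurable.integral_prod_right'
    (ν := volume.restrict {z : Sp n | ε < ‖z‖})).measurable

theorem eLpNorm_sub_eq_of_fourier {f g : L2 n} :
    eLpNorm ((f : Sp n → ℂ) - (g : Sp n → ℂ)) 2 volume =
      eLpNorm (fun ξ => (𝓕 f : L2 n) ξ - (𝓕 g : L2 n) ξ) 2 volume := by
  have h1 : ‖f - g‖ₑ = ‖(𝓕 f - 𝓕 g : L2 n)‖ₑ := by
    have h : (𝓕 f - 𝓕 g : L2 n) = 𝓕 (f - g) :=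
      (map_sub (FourierTransform.fourierCLM ℂ (L2 n)) f g).symm
    rw [h, ← ofReal_norm, ← ofReal_norm, Lp.norm_fourier_eq]
  rw [Lp.enorm_def, Lp.enorm_def, eLpNorm_congr_ae (Lp.coeFn_sub f g),
    eLpNorm_congr_ae (Lp.coeFn_sub _ _)] at h1
  exact h1

/-- Each truncation is almost everywhere the multiplier operator with symbol `truncSymbol`. By
Plancherel, L² convergence becomes dominated convergence of symbol times û. -/
theorem exists_isFracLap (hs0 : 0 < s) (hs1 : s < 1) {u : L2 n}
    (hu : MemLp (fun ξ => ((‖(2 * Real.pi) • ξ‖ ^ (2 * s) : ℝ) : ℂ) * (𝓕 u : L2 n) ξ) 2 volume) :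
    ∃ f : L2 n, IsFracLap s u f ∧ (𝓕 f : L2 n) =ᵐ[volume]
      fun ξ => ((‖(2 * Real.pi) • ξ‖ ^ (2 * s) : ℝ) : ℂ) * (𝓕 u : L2 n) ξ := by
  obtain ⟨f, hf⟩ := exists_fourier_ae_eq hu
  have hmeas : ∀ ε, AEStronglyMeasurable
      (fun ξ => ((truncSymbol s ε ξ : ℝ) : ℂ) * (𝓕 u : L2 n) ξ) volume := fun ε =>
    ((Complex.measurable_ofReal.comp (measurable_truncSymbol ε)).aestronglyMeasurable).mul
      (Lp.aestronglyMeasurable _)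
  have hm : ∀ ε, MemLp (fun ξ => ((truncSymbol s ε ξ : ℝ) : ℂ) * (𝓕 u : L2 n) ξ) 2 volume := by
    intro ε
    refine hu.of_le (hmeas ε) (ae_of_all _ fun ξ => ?_)
    rw [norm_mul, norm_mul]
    refine mul_le_mul_of_nonneg_right ?_ (norm_nonneg _)
    rw [Complex.norm_of_nonneg (truncSymbol_nonneg hs0 ε ξ), Complex.norm_of_nonneg (by positivity)]
    exact truncSymbol_le hs0 hs1 ε ξ
  choose g hg using fun ε => exists_fourier_ae_eq (hm ε)
  have hT : ∀ ε : ℝ, 0 < ε → truncLap s ε u =ᵐ[volume] g ε := by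
    intro ε hε
    have hki : Integrable (fun z : Sp n => lapConst n s * ‖z‖ ^ (-((n : ℝ) + 2 * s)))
      (volume.restrict {z : Sp n | ε < ‖z‖}) := (integrableOn_norm_rpow hs0 hε).const_mul _
    have := kernel_diff_ae_eq_of_fourier (μ := volume.restrict {z : Sp n | ε < ‖z‖})
      (k := fun z => lapConst n s * ‖z‖ ^ (-((n : ℝ) + 2 * s))) (z := id) (by fun_prop)
      measurable_id hki (u := u) (g := g ε) (by
        simp_rw [kerSymbol_trunc hs0 hε]; exact hg ε)
    rw [funext (truncLap_eq ε u)]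
    exact this
  refine ⟨f, ⟨fun ε hε => (Lp.memLp (g ε)).ae_eq (hT ε hε).symm, ?_⟩, hf⟩
  have key : Tendsto (fun ε : ℝ => eLpNorm (fun ξ => ((truncSymbol s ε ξ : ℝ) : ℂ) *
      (𝓕 u : L2 n) ξ - ((‖(2 * Real.pi) • ξ‖ ^ (2 * s) : ℝ) : ℂ) * (𝓕 u : L2 n) ξ) 2 volume)
      (𝓝[>] 0) (𝓝 0) := by
    refine tendsto_eLpNorm_two_zero_of_dominated (Eventually.of_forall fun ε =>
      (hmeas ε).sub hu.aestronglyMeasurable) hu (Eventually.of_forall fun ε =>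
      ae_of_all _ fun ξ => ?_) (ae_of_all _ fun ξ => ?_)
    · rw [← sub_mul, norm_mul, norm_mul, ← Complex.ofReal_sub, Complex.norm_real,
        Complex.norm_real, Real.norm_eq_abs, Real.norm_eq_abs]
      refine mul_le_mul_of_nonneg_right ?_ (norm_nonneg _)
      have h1 := truncSymbol_nonneg hs0 ε ξ
      have h2 := truncSymbol_le hs0 hs1 ε ξ
      rw [abs_of_nonpos (by linarith), abs_of_nonneg (by linarith)]
      linarith
    · have h1 := tendsto_truncSymbol hs0 hs1 ξ
      have h2 := (Complex.continuous_ofReal.tendsto _).comp h1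
      have h3 := (h2.mul_const ((𝓕 u : L2 n) ξ)).sub_const
        (((‖(2 * Real.pi) • ξ‖ ^ (2 * s) : ℝ) : ℂ) * (𝓕 u : L2 n) ξ)
      rw [sub_self] at h3
      exact h3
  refine key.congr' ?_
  filter_upwards [self_mem_nhdsWithin] with ε hε
  have e1 : eLpNorm (truncLap s ε u - (f : Sp n → ℂ)) 2 volume =
      eLpNorm ((g ε : Sp n → ℂ) - (f : Sp n → ℂ)) 2 volume :=
    eLpNorm_congr_ae ((hT ε hε).sub (EventuallyEq.refl _ _))
  rw [e1, eLpNorm_sub_eq_of_fourier]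
  exact (eLpNorm_congr_ae ((hg ε).sub hf)).symm

/-! ### Integration of multipliers over the sphere. -/

theorem continuous_I_mul_cpow (hs0 : 0 < s) :
    Continuous fun y : ℝ => (Complex.I * (y : ℂ)) ^ (s : ℂ) := by
  rw [continuous_iff_continuousAt]
  intro y
  exact (Complex.continuousAt_cpow_const_of_re_pos (Or.inl (by simp)) (by simpa using hs0)).comp
    (f := fun y : ℝ => Complex.I * (y : ℂ)) (by fun_prop)

theorem continuous_dirSymbol (hs0 : 0 < s) {β : Type*} [TopologicalSpace β] {f g : β → Sp n}
    (hf : Continuous f) (hg : Continuous g) : Continuous fun b => dirSymbol s (f b) (g b) :=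
  (continuous_I_mul_cpow hs0).comp (hf.inner hg)

theorem norm_dirSymbol (θ ξ : Sp n) : ‖dirSymbol s θ ξ‖ = |inner ℝ θ ξ| ^ s := by
  rw [dirSymbol, Complex.norm_cpow_real]
  simp

theorem norm_dirSymbol_le (hs0 : 0 < s) (θ : USphere n) (ξ : Sp n) :
    ‖dirSymbol s (θ : Sp n) ξ‖ ≤ ‖ξ‖ ^ s := by
  rw [norm_dirSymbol]
  have h := abs_real_inner_le_norm (θ : Sp n) ξ
  rw [norm_eq_of_mem_sphere, one_mul] at h
  exact Real.rpow_le_rpow (abs_nonneg _) h hs0.le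

theorem abs_coord_le (θ : USphere n) (i : Fin n) : |(θ : Sp n) i| ≤ 1 := by
  have := PiLp.norm_apply_le (θ : Sp n) i
  rwa [norm_eq_of_mem_sphere] at this

/-- Bochner integrals over the sphere of `L²` functions given pointwise by multipliers can be
computed pointwise. -/
theorem continuous_and_integral_of_multiplier {m : USphere n → Sp n → ℂ}
    (hm : Continuous fun p : USphere n × Sp n => m p.1 p.2) {B : Sp n → ℝ} {v : L2 n}
    (hB : ∀ θ ξ, ‖m θ ξ‖ ≤ B ξ) (hBv : MemLp (fun ξ => (B ξ : ℂ) * v ξ) 2 volume)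
    {H : USphere n → L2 n} (hH : ∀ θ, H θ =ᵐ[volume] fun ξ => m θ ξ * v ξ) :
    Integrable H (surf n) ∧
      (∫ θ, H θ ∂(surf n) : L2 n) =ᵐ[volume] fun ξ => (∫ θ, m θ ξ ∂(surf n)) * v ξ := by
  have hmθ : ∀ θ, AEStronglyMeasurable (fun ξ => m θ ξ * v ξ) volume := fun θ =>
    (hm.comp (by fun_prop : Continuous fun ξ : Sp n => (θ, ξ))).aestronglyMeasurable.mul
      (Lp.aestronglyMeasurable v)
  have hB0 : ∀ θ : USphere n, ∀ ξ, 0 ≤ B ξ := fun θ ξ => (norm_nonneg _).trans (hB θ ξ)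
  -- Continuity into L² on the compact sphere supplies strong measurability and Bochner
  -- integrability at once.
  have hHc : Continuous H := by
    rw [continuous_iff_continuousAt]
    intro θ₀
    rw [ContinuousAt, tendsto_iff_edist_tendsto_0]
    have e : ∀ θ, edist (H θ) (H θ₀) =
        eLpNorm (fun ξ => m θ ξ * v ξ - m θ₀ ξ * v ξ) 2 volume := by
      intro θ
      rw [Lp.edist_def]
      exact eLpNorm_congr_ae ((hH θ).sub (hH θ₀))
    simp_rw [e]
    refine tendsto_eLpNorm_two_zero_of_dominated (b := fun ξ => 2 * ((B ξ : ℂ) * v ξ))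
      (Eventually.of_forall fun θ => (hmθ θ).sub (hmθ θ₀)) (hBv.const_mul 2)
      (Eventually.of_forall fun θ => ae_of_all _ fun ξ => ?_) (ae_of_all _ fun ξ => ?_)
    · rw [← sub_mul, norm_mul, norm_mul, norm_mul, Complex.norm_of_nonneg (hB0 θ₀ ξ), ← mul_assoc]
      refine mul_le_mul_of_nonneg_right ?_ (norm_nonneg _)
      refine (norm_sub_le _ _).trans ?_
      have := hB θ ξ
      have := hB θ₀ ξ
      simp; linarith
    · have h1 : Continuous fun θ => m θ ξ * v ξ - m θ₀ ξ * v ξ := by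
        have := hm.comp (by fun_prop : Continuous fun θ : USphere n => (θ, ξ))
        exact (this.mul continuous_const).sub continuous_const
      have := h1.tendsto θ₀
      rwa [sub_self] at this
  have hHi : Integrable H (surf n) :=
    hHc.integrable_of_hasCompactSupport (HasCompactSupport.of_compactSpace H)
  refine ⟨hHi, ?_⟩
  have hM : AEStronglyMeasurable (fun ξ => (∫ θ, m θ ξ ∂(surf n)) * v ξ) volume := by
    refine AEStronglyMeasurable.mul ?_ (Lp.aestronglyMeasurable v)
    exact (hm.stronglyMeasurable.integral_prod_left' (μ := surf n)).aestronglyMeasurable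
  have hMb : MemLp (fun ξ => (∫ θ, m θ ξ ∂(surf n)) * v ξ) 2 volume := by
    refine MemLp.of_le_mul (c := (surf n).real univ) hBv hM (ae_of_all _ fun ξ => ?_)
    -- The sign of B is only known through a point of the sphere; for n = 0 there is none and the
    -- measure is zero.
    rcases isEmpty_or_nonempty (USphere n) with hE | ⟨⟨θ₀⟩⟩
    · have : surf n = 0 := Measure.eq_zero_of_isEmpty _
      simp [this]
    rw [norm_mul, norm_mul, Complex.norm_of_nonneg (hB0 θ₀ ξ), ← mul_assoc]
    refine mul_le_mul_of_nonneg_right ?_ (norm_nonneg _)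
    refine (norm_integral_le_of_norm_le_const (ae_of_all _ fun θ => hB θ ξ)).trans (le_of_eq ?_)
    ring
  -- The Bochner integral is identified by its inner products with all w in L², where Fubini
  -- applies.
  have key : (∫ θ, H θ ∂(surf n) : L2 n) = hMb.toLp := by
    refine ext_inner_left ℂ fun w => ?_
    rw [← integral_inner hHi w, L2.inner_def]
    have hJ : Integrable (fun p : USphere n × Sp n =>
        inner ℂ (w p.2) (m p.1 p.2 * v p.2)) ((surf n).prod volume) := by
      have h1 : Integrable (fun ξ => ‖w ξ‖ * ‖(B ξ : ℂ) * v ξ‖) volume :=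
        MemLp.integrable_mul (p := 2) (q := 2) (Lp.memLp w).norm hBv.norm
      have h2 : Integrable (fun p : USphere n × Sp n => (1 : ℝ) * (‖w p.2‖ * ‖(B p.2 : ℂ) * v p.2‖))
          ((surf n).prod volume) := (integrable_const (1 : ℝ)).mul_prod h1
      refine h2.mono' ?_ (ae_of_all _ fun p => ?_)
      · exact AEStronglyMeasurable.inner (Lp.aestronglyMeasurable w).comp_snd
          (hm.aestronglyMeasurable.mul (Lp.aestronglyMeasurable v).comp_snd)
      · refine (norm_inner_le_norm _ _).trans ?_
        rw [one_mul, norm_mul, norm_mul, Complex.norm_of_nonneg (hB0 p.1 p.2)]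
        have := hB p.1 p.2
        gcongr
    calc ∫ θ, inner ℂ w (H θ) ∂(surf n)
        = ∫ θ, (∫ ξ, inner ℂ (w ξ) (m θ ξ * v ξ)) ∂(surf n) := by
          congr 1; ext θ
          rw [L2.inner_def]
          refine integral_congr_ae ?_
          filter_upwards [hH θ] with ξ hξ
          rw [hξ]
      _ = ∫ ξ, ∫ θ, inner ℂ (w ξ) (m θ ξ * v ξ) ∂(surf n) := integral_integral_swap hJ
      _ = ∫ ξ, inner ℂ (w ξ) (hMb.toLp _ ξ) := by
          refine integral_congr_ae ?_
          filter_upwards [hMb.coeFn_toLp] with ξ hξ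
          rw [hξ]
          simp only [RCLike.inner_apply]
          rw [integral_mul_const, integral_mul_const]
  rw [key]
  exact hMb.coeFn_toLp

/-- The vector symbol `∫ θ (i θ·ξ)^s dθ` of the fractional gradient. -/
def gradSymbol (s : ℝ) (i : Fin n) (ξ : Sp n) : ℂ :=
  ∫ θ : USphere n, ((θ : Sp n) i : ℂ) * dirSymbol s (θ : Sp n) ξ ∂(surf n)

theorem norm_coord_mul_dirSymbol_le (hs0 : 0 < s) (i : Fin n) (θ : USphere n) (ξ : Sp n) :
    ‖((θ : Sp n) i : ℂ) * dirSymbol s (θ : Sp n) ξ‖ ≤ ‖ξ‖ ^ s := by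
  rw [norm_mul, Complex.norm_real, Real.norm_eq_abs]
  have h1 := abs_coord_le θ i
  have h2 := norm_dirSymbol_le hs0 θ ξ
  calc _ ≤ 1 * ‖ξ‖ ^ s := by gcongr
    _ = _ := one_mul _

theorem norm_gradSymbol_le (hs0 : 0 < s) (i : Fin n) (ξ : Sp n) :
    ‖gradSymbol s i ξ‖ ≤ ‖ξ‖ ^ s * (surf n).real univ :=
  norm_integral_le_of_norm_le_const
    (ae_of_all _ fun θ => norm_coord_mul_dirSymbol_le hs0 i θ ξ)

/-- The multiplier defines a candidate in L²; uniqueness of the weak derivative identifies it with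
the chosen value `dirDeriv`. -/
theorem fourier_dirDeriv (hs0 : 0 < s) (hs1 : s < 1) {u : L2 n}
    (hu : MemLp (fun ξ => ((‖(2 * Real.pi) • ξ‖ ^ s : ℝ) : ℂ) * (𝓕 u : L2 n) ξ) 2 volume)
    (θ : USphere n) : (∃ g, IsDirDeriv s (θ : Sp n) u g) ∧
      (𝓕 (dirDeriv s (θ : Sp n) u) : L2 n) =ᵐ[volume]
        fun ξ => dirSymbol s (θ : Sp n) ((2 * Real.pi) • ξ) * (𝓕 u : L2 n) ξ := by
  have hm : MemLp (fun ξ => dirSymbol s (θ : Sp n) ((2 * Real.pi) • ξ) * (𝓕 u : L2 n) ξ) 2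
      volume := by
    refine hu.of_le ?_ (ae_of_all _ fun ξ => ?_)
    · have h1 : Continuous fun ξ : Sp n => (2 * Real.pi) • ξ := by fun_prop
      have h2 : Continuous fun ξ : Sp n => dirSymbol s (θ : Sp n) ((2 * Real.pi) • ξ) :=
        continuous_dirSymbol hs0 continuous_const h1
      exact h2.aestronglyMeasurable.mul (Lp.aestronglyMeasurable (𝓕 u : L2 n))
    · rw [norm_mul, norm_mul, Complex.norm_of_nonneg (by positivity)]
      exact mul_le_mul_of_nonneg_right (norm_dirSymbol_le hs0 θ _) (norm_nonneg _)
  obtain ⟨g, hg⟩ := exists_fourier_ae_eq hm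
  have hD := isDirDeriv_of_fourier hs0 hs1 (norm_eq_of_mem_sphere θ) hg
  refine ⟨⟨g, hD⟩, ?_⟩
  rw [hD.dirDeriv_eq]
  exact hg

theorem fourier_real_smul (c : ℝ) (f : L2 n) : (𝓕 (c • f) : L2 n) = c • (𝓕 f : L2 n) :=
  (FourierTransform.fourierCLM ℂ (L2 n)).map_smul_of_tower c f

theorem continuous_coord_mul_dirSymbol (hs0 : 0 < s) (i : Fin n) :
    Continuous fun p : USphere n × Sp n =>
      (((p.1 : Sp n) i : ℝ) : ℂ) * dirSymbol s (p.1 : Sp n) ((2 * Real.pi) • p.2) := by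
  have h1 : Continuous fun p : USphere n × Sp n => (p.1 : Sp n) :=
    continuous_subtype_val.comp continuous_fst
  have h2 : Continuous fun p : USphere n × Sp n => (2 * Real.pi) • p.2 := by fun_prop
  have h3 : Continuous fun p : USphere n × Sp n => (((p.1 : Sp n) i : ℝ) : ℂ) := by fun_prop
  exact h3.mul (continuous_dirSymbol hs0 h1 h2)

theorem fourier_coord_smul_dirDeriv (hs0 : 0 < s) (hs1 : s < 1) {u : L2 n}
    (hu : MemLp (fun ξ => ((‖(2 * Real.pi) • ξ‖ ^ s : ℝ) : ℂ) * (𝓕 u : L2 n) ξ) 2 volume)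
    (i : Fin n) (θ : USphere n) :
    (𝓕 ((θ : Sp n) i • dirDeriv s (θ : Sp n) u) : L2 n) =ᵐ[volume]
      fun ξ => (((θ : Sp n) i : ℂ) * dirSymbol s (θ : Sp n) ((2 * Real.pi) • ξ)) *
        (𝓕 u : L2 n) ξ := by
  rw [fourier_real_smul]
  filter_upwards [Lp.coeFn_smul ((θ : Sp n) i) (𝓕 (dirDeriv s (θ : Sp n) u) : L2 n),
    (fourier_dirDeriv hs0 hs1 hu θ).2] with ξ h1 h2
  rw [h1, Pi.smul_apply, h2, Complex.real_smul, mul_assoc]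

theorem integrable_and_fourier_integral {G : USphere n → L2 n}
    (hG : Integrable (fun θ => (𝓕 (G θ) : L2 n)) (surf n)) :
    Integrable G (surf n) ∧
      (𝓕 (∫ θ, G θ ∂(surf n)) : L2 n) = ∫ θ, (𝓕 (G θ) : L2 n) ∂(surf n) := by
  have hi : Integrable G (surf n) := by
    have := (FourierTransform.fourierInvCLM ℂ (L2 n)).integrable_comp hG
    simpa using this
  exact ⟨hi, ((FourierTransform.fourierCLM ℂ (L2 n)).integral_comp_comm hi).symm⟩

theorem fourier_integral_coord_smul_dirDeriv (hs0 : 0 < s) (hs1 : s < 1) {u : L2 n}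
    (hu : MemLp (fun ξ => ((‖(2 * Real.pi) • ξ‖ ^ s : ℝ) : ℂ) * (𝓕 u : L2 n) ξ) 2 volume)
    (i : Fin n) :
    Integrable (fun θ : USphere n => (θ : Sp n) i • dirDeriv s (θ : Sp n) u) (surf n) ∧
    (𝓕 (∫ θ : USphere n, (θ : Sp n) i • dirDeriv s (θ : Sp n) u ∂(surf n)) : L2 n) =ᵐ[volume]
      fun ξ => gradSymbol s i ((2 * Real.pi) • ξ) * (𝓕 u : L2 n) ξ := by
  have key := continuous_and_integral_of_multiplier
    (m := fun θ ξ => ((θ : Sp n) i : ℂ) * dirSymbol s (θ : Sp n) ((2 * Real.pi) • ξ))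
    (B := fun ξ => ‖(2 * Real.pi) • ξ‖ ^ s) (v := 𝓕 u)
    (H := fun θ => 𝓕 ((θ : Sp n) i • dirDeriv s (θ : Sp n) u))
    (continuous_coord_mul_dirSymbol hs0 i)
    (fun θ ξ => norm_coord_mul_dirSymbol_le hs0 i θ _) hu
    (fourier_coord_smul_dirDeriv hs0 hs1 hu i)
  obtain ⟨h1, h2⟩ := integrable_and_fourier_integral key.1
  exact ⟨h1, h2 ▸ key.2⟩

/-! ### Symmetries of the sphere and evaluation of the vector symbol. -/

/-- The action of a linear isometry on the unit sphere. -/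
def sphereMap (A : Sp n ≃ₗᵢ[ℝ] Sp n) (θ : USphere n) : USphere n :=
  ⟨A θ, by simp⟩

theorem continuous_sphereMap (A : Sp n ≃ₗᵢ[ℝ] Sp n) : Continuous (sphereMap A) := by
  unfold sphereMap; fun_prop

-- The surface measure of S is defined through the volume of the cone (0,1)·S, and a linear isometry
-- maps cones to cones and preserves volume.
open scoped Pointwise in
theorem measurePreserving_sphereMap (A : Sp n ≃ₗᵢ[ℝ] Sp n) :
    MeasurePreserving (sphereMap A) (surf n) (surf n) := by
  refine ⟨(continuous_sphereMap A).measurable, ?_⟩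
  ext S hS
  have hm := (continuous_sphereMap A).measurable
  rw [Measure.map_apply hm hS, Measure.toSphere_apply' _ (hm hS), Measure.toSphere_apply' _ hS]
  congr 1
  have e : Ioo (0 : ℝ) 1 • ((↑) '' (sphereMap A ⁻¹' S) : Set (Sp n)) =
      A ⁻¹' (Ioo (0 : ℝ) 1 • ((↑) '' S : Set (Sp n))) := by
    ext x
    simp only [Set.mem_smul, mem_image, mem_preimage]
    constructor
    · rintro ⟨r, hr, _, ⟨θ, hθ, rfl⟩, rfl⟩
      exact ⟨r, hr, _, ⟨_, hθ, rfl⟩, by simp [sphereMap]⟩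
    · rintro ⟨r, hr, _, ⟨θ, hθ, rfl⟩, hx⟩
      refine ⟨r, hr, _, ⟨sphereMap A.symm θ, ?_, rfl⟩, ?_⟩
      · have : sphereMap A (sphereMap A.symm θ) = θ := by
          ext1; simp [sphereMap]
        rwa [this]
      · apply A.injective
        rw [← hx]; simp [sphereMap]
  rw [e]
  exact A.measurePreserving.measure_preimage_emb A.toHomeomorph.measurableEmbedding _

theorem integral_sphereMap {E : Type*} [NormedAddCommGroup E] [NormedSpace ℝ E]
    (A : Sp n ≃ₗᵢ[ℝ] Sp n) {g : Sp n → E} (hg : Continuous g) :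
    ∫ θ : USphere n, g (A θ) ∂(surf n) = ∫ θ : USphere n, g θ ∂(surf n) := by
  have hmp := measurePreserving_sphereMap A
  have hg' : Continuous fun θ : USphere n => g θ := hg.comp continuous_subtype_val
  conv_rhs => rw [← hmp.map_eq]
  rw [integral_map hmp.measurable.aemeasurable (hg'.aestronglyMeasurable_of_compactSpace)]
  rfl

theorem integrable_sphere_of_continuous {E : Type*} [NormedAddCommGroup E]
    {g : USphere n → E} (hg : Continuous g) :
    Integrable g (surf n) :=
  hg.integrable_of_hasCompactSupport (HasCompactSupport.of_compactSpace g)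

/-- Reflection in the hyperplane orthogonal to ζ fixes θ·η and changes the sign of θ·ζ, so the
integral equals its negative. -/
theorem integral_inner_mul_dirSymbol_of_orthogonal (hs0 : 0 < s) {ζ η : Sp n}
    (h : inner ℝ ζ η = 0) :
    ∫ θ : USphere n, ((inner ℝ (θ : Sp n) ζ : ℝ) : ℂ) * dirSymbol s (θ : Sp n) η ∂(surf n) = 0 := by
  set R : Sp n ≃ₗᵢ[ℝ] Sp n := (ℝ ∙ ζ)ᗮ.reflection with hR
  have hζ : R ζ = -ζ := Submodule.reflection_orthogonalComplement_singleton_eq_neg ζ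
  have hη : R η = η := by
    refine Submodule.reflection_mem_subspace_eq_self ?_
    rw [Submodule.mem_orthogonal_singleton_iff_inner_right]
    exact h
  have hc : Continuous fun x : Sp n => ((inner ℝ x ζ : ℝ) : ℂ) * dirSymbol s x η := by
    have := continuous_dirSymbol hs0 (continuous_id (X := Sp n)) (continuous_const (y := η))
    exact Continuous.mul (by fun_prop) this
  have key := integral_sphereMap R hc
  have e : ∀ θ : USphere n, ((inner ℝ (R θ) ζ : ℝ) : ℂ) * dirSymbol s (R θ) η =
      -(((inner ℝ (θ : Sp n) ζ : ℝ) : ℂ) * dirSymbol s (θ : Sp n) η) := by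
    intro θ
    have h1 : inner ℝ (R θ) η = inner ℝ (θ : Sp n) η := by
      conv_lhs => rw [← hη]
      exact R.inner_map_map _ _
    have h2 : inner ℝ (R θ) ζ = -inner ℝ (θ : Sp n) ζ := by
      have := R.inner_map_map (θ : Sp n) ζ
      rw [hζ, inner_neg_right] at this
      linarith
    rw [dirSymbol, h1, h2, dirSymbol]; push_cast; ring
  simp_rw [e] at key
  rw [integral_neg] at key
  have : (2 : ℂ) * ∫ θ : USphere n, ((inner ℝ (θ : Sp n) ζ : ℝ) : ℂ) *
      dirSymbol s (θ : Sp n) η ∂(surf n) = 0 := by linear_combination -key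
  simpa using this

/-- For y > 0 the principal arguments of ±iy are ±π/2, so the powers differ by 2i sin(πs/2) y^s;
both sides are even in y. -/
theorem mul_cpow_sub_cpow_neg (hs0 : 0 < s) (y : ℝ) :
    (y : ℂ) * ((Complex.I * (y : ℂ)) ^ (s : ℂ) - (Complex.I * ((-y : ℝ) : ℂ)) ^ (s : ℂ)) =
      2 * Complex.I * (Real.sin (Real.pi * s / 2) * |y| ^ (1 + s) : ℝ) := by
  have pos : ∀ y : ℝ, 0 < y →
      (y : ℂ) * ((Complex.I * (y : ℂ)) ^ (s : ℂ) - (Complex.I * ((-y : ℝ) : ℂ)) ^ (s : ℂ)) =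
      2 * Complex.I * (Real.sin (Real.pi * s / 2) * |y| ^ (1 + s) : ℝ) := by
    intro y hy
    have hy' : (y : ℂ) ≠ 0 := by exact_mod_cast hy.ne'
    have h1 : (Complex.I * (y : ℂ)) ^ (s : ℂ) =
        ((y ^ s : ℝ) : ℂ) * Complex.exp ((Real.pi * s / 2 : ℝ) * Complex.I) := by
      rw [Complex.cpow_def_of_ne_zero (by simp [hy']), mul_comm Complex.I,
        Complex.log_ofReal_mul hy Complex.I_ne_zero, Complex.log_I, add_mul, Complex.exp_add,
        Real.rpow_def_of_pos hy]
      push_cast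
      congr 2; ring
    have h2 : (Complex.I * ((-y : ℝ) : ℂ)) ^ (s : ℂ) =
        ((y ^ s : ℝ) : ℂ) * Complex.exp ((-(Real.pi * s / 2) : ℝ) * Complex.I) := by
      rw [show Complex.I * ((-y : ℝ) : ℂ) = (y : ℂ) * (-Complex.I) by push_cast; ring,
        Complex.cpow_def_of_ne_zero (by simp [hy']),
        Complex.log_ofReal_mul hy (by simp), Complex.log_neg_I, add_mul, Complex.exp_add,
        Real.rpow_def_of_pos hy]
      push_cast
      congr 2; ring
    rw [h1, h2, Complex.exp_mul_I, Complex.exp_mul_I, ← Complex.ofReal_cos, ← Complex.ofReal_cos,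
      ← Complex.ofReal_sin, ← Complex.ofReal_sin, Real.cos_neg, Real.sin_neg, abs_of_pos hy,
      Real.rpow_add hy, Real.rpow_one]
    push_cast; ring
  rcases lt_trichotomy y 0 with hy | rfl | hy
  · have := pos (-y) (by linarith)
    rw [neg_neg, abs_neg] at this
    rw [← this]; push_cast; ring
  · simp [Real.zero_rpow (by linarith : 1 + s ≠ 0)]
  · exact pos y hy

/-- Averaging over θ and −θ brings in the odd part of the symbol, computed in
`mul_cpow_sub_cpow_neg`. This makes the value purely imaginary. -/
theorem integral_inner_mul_dirSymbol_self (hs0 : 0 < s) (η : Sp n) :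
    ∫ θ : USphere n, ((inner ℝ (θ : Sp n) η : ℝ) : ℂ) * dirSymbol s (θ : Sp n) η ∂(surf n) =
      Complex.I * (Real.sin (Real.pi * s / 2) *
        ∫ θ : USphere n, |inner ℝ (θ : Sp n) η| ^ (1 + s) ∂(surf n) : ℝ) := by
  have hc : Continuous fun x : Sp n => ((inner ℝ x η : ℝ) : ℂ) * dirSymbol s x η := by
    have := continuous_dirSymbol hs0 (continuous_id (X := Sp n)) (continuous_const (y := η))
    exact Continuous.mul (by fun_prop) this
  have key := integral_sphereMap (LinearIsometryEquiv.neg ℝ) hc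
  have i1 := integrable_sphere_of_continuous (hc.comp (continuous_subtype_val
    (p := fun x => x ∈ Metric.sphere (0 : Sp n) 1)))
  have i2 := integrable_sphere_of_continuous ((hc.comp (LinearIsometryEquiv.neg ℝ
    (E := Sp n)).continuous).comp (continuous_subtype_val
    (p := fun x => x ∈ Metric.sphere (0 : Sp n) 1)))
  have h2 := integral_add i1 i2
  simp only [Function.comp_apply] at h2
  rw [key] at h2
  have e : ∀ θ : USphere n, ((inner ℝ (θ : Sp n) η : ℝ) : ℂ) * dirSymbol s (θ : Sp n) η +
      ((inner ℝ (LinearIsometryEquiv.neg ℝ (θ : Sp n)) η : ℝ) : ℂ) *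
        dirSymbol s (LinearIsometryEquiv.neg ℝ (θ : Sp n)) η =
      2 * Complex.I * (Real.sin (Real.pi * s / 2) * |inner ℝ (θ : Sp n) η| ^ (1 + s) : ℝ) := by
    intro θ
    rw [← mul_cpow_sub_cpow_neg hs0, dirSymbol, dirSymbol]
    simp only [LinearIsometryEquiv.coe_neg, inner_neg_left]
    push_cast; ring
  simp_rw [e] at h2
  rw [integral_const_mul, integral_complex_ofReal, integral_const_mul] at h2
  linear_combination (-1 / 2 : ℂ) * h2

/-- The reflection in the hyperplane orthogonal to e − e' carries e to e', and the measure is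
invariant. -/
theorem integral_inner_rpow_eq (hs0 : 0 < s) {e e' : Sp n} (h : ‖e‖ = ‖e'‖) :
    ∫ θ : USphere n, |inner ℝ (θ : Sp n) e| ^ (1 + s) ∂(surf n) =
      ∫ θ : USphere n, |inner ℝ (θ : Sp n) e'| ^ (1 + s) ∂(surf n) := by
  set R : Sp n ≃ₗᵢ[ℝ] Sp n := (ℝ ∙ (e - e'))ᗮ.reflection with hR
  have hRe : R e = e' := Submodule.reflection_sub h
  have hc : Continuous fun x : Sp n => |inner ℝ x e'| ^ (1 + s) := by
    have h1 : Continuous fun x : Sp n => |inner ℝ x e'| := by fun_prop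
    exact h1.rpow_const fun x => Or.inr (by linarith)
  rw [← integral_sphereMap R hc, ← hRe]
  simp_rw [R.inner_map_map]

/-- Split the i-th basis vector into its projection on η and a part ζ orthogonal to η; the
orthogonal part contributes nothing. -/
theorem gradSymbol_eq (hs0 : 0 < s) (i : Fin n) {η : Sp n} (hη : η ≠ 0) :
    gradSymbol s i η = ((η i / ‖η‖ ^ 2 : ℝ) : ℂ) * (Complex.I * (Real.sin (Real.pi * s / 2) *
        ∫ θ : USphere n, |inner ℝ (θ : Sp n) η| ^ (1 + s) ∂(surf n) : ℝ)) := by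
  have hη0 : ‖η‖ ≠ 0 := norm_ne_zero_iff.2 hη
  set c : ℝ := η i / ‖η‖ ^ 2 with hc
  set ζ : Sp n := EuclideanSpace.single i 1 - c • η with hζ
  have horth : inner ℝ ζ η = 0 := by
    rw [hζ, inner_sub_left, inner_smul_left, real_inner_self_eq_norm_sq,
      EuclideanSpace.inner_single_left, hc]
    simp only [map_one, one_mul, conj_trivial]
    field_simp
    ring
  have h0 := integral_inner_mul_dirSymbol_of_orthogonal hs0 horth
  rw [← integral_inner_mul_dirSymbol_self hs0, ← integral_const_mul, ← sub_eq_zero, gradSymbol]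
  have hd : Continuous fun θ : USphere n => dirSymbol s (θ : Sp n) η :=
    continuous_dirSymbol hs0 continuous_subtype_val continuous_const
  have i1 : Integrable (fun θ : USphere n => ((θ : Sp n) i : ℂ) * dirSymbol s (θ : Sp n) η)
      (surf n) := by
    refine integrable_sphere_of_continuous (Continuous.mul (by fun_prop) hd)
  have i2 : Integrable (fun θ : USphere n => (c : ℂ) * (((inner ℝ (θ : Sp n) η : ℝ) : ℂ) *
      dirSymbol s (θ : Sp n) η)) (surf n) :=
    integrable_sphere_of_continuous (continuous_const.mul (Continuous.mul (by fun_prop) hd))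
  rw [← integral_sub i1 i2, ← h0]
  congr 1; ext θ
  rw [hζ, inner_sub_right, inner_smul_right, EuclideanSpace.inner_single_right]
  simp only [one_mul, conj_trivial]
  push_cast; ring

/-- The constant `D_{n,s}`. -/
def divGradConst (n : ℕ) (hn : 1 ≤ n) (s : ℝ) : ℝ :=
  -(Real.sin (Real.pi * s / 2) *
    ∫ θ : USphere n, |(θ : Sp n) ⟨0, hn⟩| ^ (1 + s) ∂(surf n)) ^ 2

theorem divGradConst_neg (hn : 1 ≤ n) (hs0 : 0 < s) (hs1 : s < 1) : divGradConst n hn s < 0 := by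
  have h1 : 0 < Real.sin (Real.pi * s / 2) :=
    Real.sin_pos_of_pos_of_lt_pi (by positivity) (by nlinarith [Real.pi_pos])
  have h2 : 0 < ∫ θ : USphere n, |(θ : Sp n) ⟨0, hn⟩| ^ (1 + s) ∂(surf n) := by
    have hc : Continuous fun θ : USphere n => |(θ : Sp n) ⟨0, hn⟩| ^ (1 + s) := by
      have h1 : Continuous fun θ : USphere n => |(θ : Sp n) ⟨0, hn⟩| := by fun_prop
      exact h1.rpow_const fun x => Or.inr (by linarith)
    refine hc.integral_pos_of_hasCompactSupport_nonneg_nonzero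
      (x := ⟨EuclideanSpace.single ⟨0, hn⟩ 1, by simp⟩)
      (HasCompactSupport.of_compactSpace _) (fun θ => by positivity) ?_
    simp
  unfold divGradConst
  have := pow_pos (mul_pos h1 h2) 2
  linarith

/-- The symbol is i times a real multiple of η, so its bilinear square is negative. Scaling gives
‖η‖^{2(1+s)} · ‖η‖² / ‖η‖⁴ = ‖η‖^{2s}. -/
theorem sum_gradSymbol_sq (hn : 1 ≤ n) (hs0 : 0 < s) (η : Sp n) :
    ∑ i, gradSymbol s i η * gradSymbol s i η =
      ((divGradConst n hn s * ‖η‖ ^ (2 * s) : ℝ) : ℂ) := by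
  by_cases hη : η = 0
  · have hs : (s : ℂ) ≠ 0 := by exact_mod_cast hs0.ne'
    simp [hη, gradSymbol, dirSymbol, hs, Real.zero_rpow (by linarith : 2 * s ≠ 0)]
  have hη0 : 0 < ‖η‖ := norm_pos_iff.2 hη
  have hK : ∫ θ : USphere n, |inner ℝ (θ : Sp n) η| ^ (1 + s) ∂(surf n) =
      ‖η‖ ^ (1 + s) * ∫ θ : USphere n, |(θ : Sp n) ⟨0, hn⟩| ^ (1 + s) ∂(surf n) := by
    rw [integral_inner_rpow_eq (e' := ‖η‖ • EuclideanSpace.single ⟨0, hn⟩ 1) hs0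
      (by simp [norm_smul]), ← integral_const_mul]
    congr 1; ext θ
    rw [inner_smul_right, EuclideanSpace.inner_single_right, abs_mul, abs_of_pos hη0,
      Real.mul_rpow hη0.le (abs_nonneg _)]
    simp
  simp_rw [gradSymbol_eq hs0 _ hη, hK]
  set K := ∫ θ : USphere n, |(θ : Sp n) ⟨0, hn⟩| ^ (1 + s) ∂(surf n) with hKd
  have hsum : ∑ i, η i * η i = ‖η‖ ^ 2 := by
    rw [EuclideanSpace.norm_sq_eq]
    simp [sq]
  have e : ∀ i, ((η i / ‖η‖ ^ 2 : ℝ) : ℂ) *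
      (Complex.I * (Real.sin (Real.pi * s / 2) * (‖η‖ ^ (1 + s) * K) : ℝ)) *
      (((η i / ‖η‖ ^ 2 : ℝ) : ℂ) *
      (Complex.I * (Real.sin (Real.pi * s / 2) * (‖η‖ ^ (1 + s) * K) : ℝ))) =
      ((η i * η i * (-((Real.sin (Real.pi * s / 2) * (‖η‖ ^ (1 + s) * K)) ^ 2 / ‖η‖ ^ 4)) : ℝ) :
        ℂ) := by
    intro i
    push_cast
    have : (‖η‖ : ℂ) ≠ 0 := by exact_mod_cast hη0.ne'
    field_simp
    rw [Complex.I_sq]; ring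
  simp_rw [e]
  rw [← Complex.ofReal_sum, ← Finset.sum_mul, hsum, divGradConst, ← hKd]
  congr 1
  have h1 : ‖η‖ ^ (1 + s) = ‖η‖ * ‖η‖ ^ s := by rw [Real.rpow_add hη0, Real.rpow_one]
  have h2 : ‖η‖ ^ (2 * s) = ‖η‖ ^ s * ‖η‖ ^ s := by rw [two_mul, Real.rpow_add hη0]
  rw [h1, h2]
  field_simp

/-- Expanding θ·θ' in coordinates separates the variables. -/
theorem sphereIntegral_eq_sum (hs0 : 0 < s) (ξ : Sp n) :
    sphereIntegral n s ξ = ∑ i, gradSymbol s i ξ * gradSymbol s i ξ := by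
  have hd : Continuous fun θ : USphere n => dirSymbol s (θ : Sp n) ξ :=
    continuous_dirSymbol hs0 continuous_subtype_val continuous_const
  have i1 : ∀ i, Integrable (fun θ : USphere n => ((θ : Sp n) i : ℂ) * dirSymbol s (θ : Sp n) ξ)
      (surf n) := fun i => integrable_sphere_of_continuous (Continuous.mul (by fun_prop) hd)
  have e : ∀ θ θ' : USphere n, ((inner ℝ (θ : Sp n) (θ' : Sp n) : ℝ) : ℂ)
      * (Complex.I * ((inner ℝ (θ : Sp n) ξ : ℝ) : ℂ)) ^ (s : ℂ)
      * (Complex.I * ((inner ℝ (θ' : Sp n) ξ : ℝ) : ℂ)) ^ (s : ℂ) =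
      ∑ i, (((θ : Sp n) i : ℂ) * dirSymbol s (θ : Sp n) ξ) *
        (((θ' : Sp n) i : ℂ) * dirSymbol s (θ' : Sp n) ξ) := by
    intro θ θ'
    have : inner ℝ (θ : Sp n) (θ' : Sp n) = ∑ i, (θ : Sp n) i * (θ' : Sp n) i := by
      simp [PiLp.inner_apply, mul_comm]
    rw [this]
    push_cast
    rw [Finset.sum_mul, Finset.sum_mul]
    refine Finset.sum_congr rfl fun i _ => ?_
    simp only [dirSymbol]; ring
  rw [sphereIntegral]
  simp_rw [e]
  have e2 : ∀ θ : USphere n, ∫ θ' : USphere n, ∑ i, (((θ : Sp n) i : ℂ) * dirSymbol s (θ : Sp n) ξ) *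
        (((θ' : Sp n) i : ℂ) * dirSymbol s (θ' : Sp n) ξ) ∂(surf n) =
      ∑ i, (((θ : Sp n) i : ℂ) * dirSymbol s (θ : Sp n) ξ) * gradSymbol s i ξ := by
    intro θ
    rw [integral_finsetSum _ fun i _ => (i1 i).const_mul _]
    simp_rw [integral_const_mul, gradSymbol]
  simp_rw [e2]
  rw [integral_finsetSum _ fun i _ => (i1 i).mul_const _]
  simp_rw [integral_mul_const, gradSymbol]

/-! ### Sobolev weights and the composition of divergence with gradient. -/

/-- Sobolev membership is an equality of tempered distributions; testing it on smooth compactly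
supported functions turns it into an almost everywhere equality with an L² function. -/
theorem MemH.memLp_weight_fourier {r : ℝ} {u : L2 n} (hu : MemH r u) :
    MemLp (fun ξ => (((1 + ‖ξ‖ ^ 2) ^ (r / 2) : ℝ) : ℂ) * (𝓕 u : L2 n) ξ) 2 volume := by
  obtain ⟨f, hf⟩ := TemperedDistribution.memSobolev_iff_exists_smulLeftCLM_fourier.1 hu
  rw [Lp.fourier_toTemperedDistribution_eq] at hf
  set w : Sp n → ℂ := fun ξ => (((1 + ‖ξ‖ ^ 2) ^ (r / 2) : ℝ) : ℂ) with hw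
  have hwt : w.HasTemperateGrowth := by fun_prop
  have hwc : Continuous w := hwt.1.continuous
  have hloc : LocallyIntegrable (fun ξ => w ξ * (𝓕 u : L2 n) ξ) volume := by
    have h1 : LocallyIntegrable ((𝓕 u : L2 n) : Sp n → ℂ) volume :=
      (Lp.memLp _).locallyIntegrable (by norm_num)
    rw [locallyIntegrable_iff] at h1 ⊢
    exact fun K hK => (h1 K hK).continuousOn_mul hwc.continuousOn hK
  have key : (fun ξ => w ξ * (𝓕 u : L2 n) ξ) =ᵐ[volume] f := by
    refine ae_eq_of_integral_contDiff_smul_eq hloc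
      ((Lp.memLp f).locallyIntegrable (by norm_num)) fun φ hφ hc => ?_
    have hc' : HasCompactSupport (fun x => (φ x : ℂ)) := hc.comp_left (g := Complex.ofReal) rfl
    have hφ' : ContDiff ℝ ∞ (fun x => (φ x : ℂ)) := Complex.ofRealCLM.contDiff.comp hφ
    have := congrArg (fun T : 𝓢'(Sp n, ℂ) => T (hc'.toSchwartzMap hφ')) hf
    simp only [TemperedDistribution.smulLeftCLM_apply_apply, Lp.toTemperedDistribution_apply] at this
    calc ∫ ξ, φ ξ • (w ξ * (𝓕 u : L2 n) ξ)
        = ∫ ξ, (SchwartzMap.smulLeftCLM ℂ w (hc'.toSchwartzMap hφ')) ξ • (𝓕 u : L2 n) ξ := by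
          congr 1; ext ξ
          rw [SchwartzMap.smulLeftCLM_apply_apply hwt]
          simp only [HasCompactSupport.toSchwartzMap_toFun, smul_eq_mul, Complex.real_smul]
          ring
      _ = _ := this
      _ = _ := by congr 1
  exact (Lp.memLp f).ae_eq key.symm

theorem memLp_norm_rpow_fourier {r q : ℝ} (hq : 0 ≤ q) (hqr : q ≤ r) {u : L2 n} (hu : MemH r u) :
    MemLp (fun ξ => ((‖(2 * Real.pi) • ξ‖ ^ q : ℝ) : ℂ) * (𝓕 u : L2 n) ξ) 2 volume := by
  refine MemLp.of_le_mul (c := (2 * Real.pi) ^ q) hu.memLp_weight_fourier ?_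
    (ae_of_all _ fun ξ => ?_)
  · exact AEStronglyMeasurable.mul (Measurable.aestronglyMeasurable (by fun_prop))
      (Lp.aestronglyMeasurable (𝓕 u : L2 n))
  · rw [norm_mul, norm_mul, Complex.norm_of_nonneg (by positivity),
      Complex.norm_of_nonneg (by positivity), ← mul_assoc, norm_smul,
      Real.norm_of_nonneg (by positivity : 0 ≤ 2 * Real.pi),
      Real.mul_rpow (by positivity) (norm_nonneg _)]
    refine mul_le_mul_of_nonneg_right (mul_le_mul_of_nonneg_left ?_ (by positivity)) (norm_nonneg _)
    have h1 : ‖ξ‖ ^ q = (‖ξ‖ ^ 2) ^ (q / 2) := by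
      rw [← Real.rpow_natCast, ← Real.rpow_mul (norm_nonneg _)]
      congr 1; push_cast; ring
    rw [h1]
    calc (‖ξ‖ ^ 2) ^ (q / 2) ≤ (1 + ‖ξ‖ ^ 2) ^ (q / 2) := by gcongr; linarith
      _ ≤ (1 + ‖ξ‖ ^ 2) ^ (r / 2) :=
        Real.rpow_le_rpow_of_exponent_le (by nlinarith [sq_nonneg ‖ξ‖]) (by linarith)

theorem fourier_sum {ι : Type*} (t : Finset ι) (f : ι → L2 n) :
    (𝓕 (∑ i ∈ t, f i) : L2 n) = ∑ i ∈ t, (𝓕 (f i) : L2 n) :=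
  map_sum (FourierTransform.fourierCLM ℂ (L2 n)) f t

theorem eq_of_fourier_ae_eq {f g : L2 n} (h : (𝓕 f : L2 n) =ᵐ[volume] (𝓕 g : L2 n)) : f = g :=
  (Lp.fourierTransformₗᵢ (Sp n) ℂ).injective (Lp.ext h)

/-- The gradient symbol grows at most like ‖η‖^s, so of the 2s derivatives of u there remain s,
enough to apply the directional derivatives once more. -/
theorem memLp_norm_rpow_fourier_fracGrad (hs0 : 0 < s) (hs1 : s < 1) {u : L2 n}
    (hu : MemH (2 * s) u) (i : Fin n) :
    MemLp (fun ξ => ((‖(2 * Real.pi) • ξ‖ ^ s : ℝ) : ℂ) * (𝓕 (fracGrad s u i) : L2 n) ξ) 2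
      volume := by
  have h1 := (fourier_integral_coord_smul_dirDeriv hs0 hs1
    (memLp_norm_rpow_fourier hs0.le (by linarith) hu) i).2
  have h2 := memLp_norm_rpow_fourier (q := 2 * s) (by linarith) le_rfl hu
  refine MemLp.of_le_mul (c := (surf n).real univ) h2 ?_ ?_
  · exact AEStronglyMeasurable.mul (Measurable.aestronglyMeasurable (by fun_prop))
      (Lp.aestronglyMeasurable (𝓕 (fracGrad s u i) : L2 n))
  · filter_upwards [h1] with ξ hξ
    have e : (𝓕 (fracGrad s u i) : L2 n) ξ =
      gradSymbol s i ((2 * Real.pi) • ξ) * (𝓕 u : L2 n) ξ := hξ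
    have h3 := norm_gradSymbol_le hs0 i ((2 * Real.pi) • ξ)
    rw [e, norm_mul, norm_mul, norm_mul, Complex.norm_of_nonneg (by positivity),
      Complex.norm_of_nonneg (by positivity)]
    have h4 : ‖(2 * Real.pi) • ξ‖ ^ (2 * s) = ‖(2 * Real.pi) • ξ‖ ^ s * ‖(2 * Real.pi) • ξ‖ ^ s := by
      rw [← Real.rpow_add_of_nonneg (norm_nonneg _) hs0.le hs0.le, ← two_mul]
    rw [h4]
    calc _ ≤ ‖(2 * Real.pi) • ξ‖ ^ s * ((‖(2 * Real.pi) • ξ‖ ^ s * (surf n).real univ) *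
          ‖(𝓕 u : L2 n) ξ‖) := by gcongr
      _ = _ := by ring

theorem fourier_fracDiv_fracGrad (hn : 1 ≤ n) (hs0 : 0 < s) (hs1 : s < 1) {u : L2 n}
    (hu : MemH (2 * s) u) :
    (𝓕 (fracDiv s (fracGrad s u)) : L2 n) =ᵐ[volume] fun ξ =>
      (divGradConst n hn s : ℂ) *
        (((‖(2 * Real.pi) • ξ‖ ^ (2 * s) : ℝ) : ℂ) * (𝓕 u : L2 n) ξ) := by
  have h1 := fun i => fourier_integral_coord_smul_dirDeriv hs0 hs1
    (memLp_norm_rpow_fourier hs0.le (by linarith) hu) i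
  have h2 := fun i => fourier_integral_coord_smul_dirDeriv hs0 hs1
    (memLp_norm_rpow_fourier_fracGrad hs0 hs1 hu i) i
  rw [fracDiv, integral_finsetSum _ fun i _ => (h2 i).1, fourier_sum]
  have e1 := Lp.coeFn_finsetSum (μ := (volume : Measure (Sp n))) (p := 2) Finset.univ
    fun i : Fin n => (𝓕 (∫ θ : USphere n, (θ : Sp n) i •
      dirDeriv s (θ : Sp n) (fracGrad s u i) ∂(surf n)) : L2 n)
  filter_upwards [e1, ae_all_iff.2 fun i => (h1 i).2, ae_all_iff.2 fun i => (h2 i).2]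
    with ξ a1 a2 a3
  rw [a1]
  have a2' : ∀ i, (𝓕 (fracGrad s u i) : L2 n) ξ =
    gradSymbol s i ((2 * Real.pi) • ξ) * (𝓕 u : L2 n) ξ := a2
  rw [Finset.sum_apply]
  simp_rw [a3, a2', ← mul_assoc]
  rw [← Finset.sum_mul, sum_gradSymbol_sq hn hs0]
  push_cast; ring

end FracCalc

end

theorem theorem3p2 (n : ℕ) (hn : 1 ≤ n) (s : ℝ) (hs0 : 0 < s) (hs1 : s < 1) :
    ∃ D : ℝ, D < 0 ∧
      (∀ ξ : FracCalc.Sp n,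
        FracCalc.sphereIntegral n s ξ = ((D * ‖ξ‖ ^ (2 * s) : ℝ) : ℂ)) ∧
      ∀ u : FracCalc.L2 n, FracCalc.MemH (2 * s) u →
        FracCalc.HasFracGrad s u ∧
        FracCalc.HasFracDiv s (FracCalc.fracGrad s u) ∧
        (∃ f, FracCalc.IsFracLap s u f) ∧
        FracCalc.fracDiv s (FracCalc.fracGrad s u) = (D : ℂ) • FracCalc.fracLap s u := by
  open FracCalc in
  refine ⟨divGradConst n hn s, divGradConst_neg hn hs0 hs1, fun ξ => ?_, fun u hu => ?_⟩
  · rw [sphereIntegral_eq_sum hs0, sum_gradSymbol_sq hn hs0]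
  have hw := memLp_norm_rpow_fourier hs0.le (by linarith) hu
  have hv := fun i => memLp_norm_rpow_fourier_fracGrad hs0 hs1 hu i
  obtain ⟨f, hf, hfF⟩ := exists_isFracLap hs0 hs1
    (memLp_norm_rpow_fourier (q := 2 * s) (by linarith) le_rfl hu)
  refine ⟨⟨fun θ => (fourier_dirDeriv hs0 hs1 hw θ).1,
      fun i => (fourier_integral_coord_smul_dirDeriv hs0 hs1 hw i).1⟩,
    ⟨fun θ i => (fourier_dirDeriv hs0 hs1 (hv i) θ).1,
      integrable_finsetSum _ fun i _ =>
        (fourier_integral_coord_smul_dirDeriv hs0 hs1 (hv i) i).1⟩, ⟨f, hf⟩, ?_⟩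
  rw [hf.fracLap_eq]
  -- On the Fourier side both sides are the constant times ‖2πξ‖^{2s} û.
  refine eq_of_fourier_ae_eq ?_
  rw [FourierTransform.fourier_smul]
  filter_upwards [fourier_fracDiv_fracGrad hn hs0 hs1 hu, hfF,
    Lp.coeFn_smul (divGradConst n hn s : ℂ) (FourierTransform.fourier f : L2 n)] with ξ h1 h2 h3
  rw [h1, h3, Pi.smul_apply, h2, smul_eq_mul]
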